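/- **Setting.** Let $H=\sum_{\mathbf m} c_{\mathbf m}\mathbf z^{\mathbf m}\in\mathbb C[z_1^{\pm1},\dots,z_d^{\pm1}]$ be a Laurent polynomial whose Newton polytope $\mathcal P\subseteq\mathbb R^d$ has dimension $d$, and suppose that $V^*=\{\mathbf z\in(\mathbb C^*)^d : H(\mathbf z)=0\}$ is smooth ($\nabla H\neq\mathbf 0$ on $V^*$). Write $\nabla_{\log}f=(z_1\partial f/\partial z_1,\dots,z_d\partial f/\partial z_d)$. Let $\kappa\ge1$ be an integer such that $Q=\kappa\mathcal P$ is a normal lattice polytope, let $\mathbf m_1,\dots,\mathbf m_s$ be the lattice points of $Q$, let $\Phi:(\mathbb C^*)^d\to\mathbb{CP}^{s-1}$, $\Phi(\mathbf z)=[\mathbf z^{\mathbf m_1}:\dots:\mathbf z^{\mathbf m_s}]$, and let $X_A$ be the closure of the image of $\Phi$. For a face $F$ of $Q$, let $X^0(F)$ be the set of $p\in X_A$ whose nonzero homogeneous coordinates are exactly those belonging to lattice points in $F$; let $L_F\subseteq\mathbb R^d$ be the linear span of the differences of points of $F$; and let $\sigma_F$ be the nonnegative linear span of $L_F+(Q-\mathbf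 v)$, where $\mathbf v$ is a vertex of $F$. A direction $R\in\mathbb{CP}^{d-1}$ is parallel to $F$ if it lies in $L_F\otimes\mathbb C$. A point $p\in X_A\setminus\Phi(V^*)$ is a *critical point at infinity (CPAI) in direction* $R\in\mathbb{CP}^{d-1}$ if there is a sequence $(\mathbf z_n)$ in $V^*$ with $\Phi(\mathbf z_n)\to p$ and $[\nabla_{\log}H(\mathbf z_n)]\to R$ in $\mathbb{CP}^{d-1}$. Let $\mathcal F$ be a face of $\mathcal P$ of codimension $k$, $F=\kappa\mathcal F$ the corresponding face of $Q$, and $\mathfrak v$ a vertex of $\mathcal F$. Suppose that the cone $\sigma_F/L_F\subseteq\mathbb R^d/L_F$ is simplicial (generated by linearly independent vectors). Then $\mathcal F$ is the intersection of $k$ facets $\mathcal F_1,\dots,\mathcal F_k$ of $\mathcal P$. Let $N$ be any integer $d\times d$ matrix with $\det N\ne0$ whose last $k$ columns are the inward-pointing normals of $\mathcal F_1,\dots,\mathcal F_k$ (the shortest nonzero integer vectors normal to the facets and pointing into $\mathcal P$). Let $\tau_N(\mathbf w)=\bigl(\prod_j w_j^{N_{1j}},\dots,\prod_j w_j^{N_{dj}}\bigr)$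 and $\overline H=(\mathbf z^{-\mathfrak v}H)\circ\tau_N$, a Laurent polynomial without negative powers of the last $k$ variables. **Theorem.** Let $(\mathbf z_n)$ be a sequence in $V^*$ such that $\Phi(\mathbf z_n)$ converges to a point $p\in X^0(F)$, the directions $[\nabla_{\log}H(\mathbf z_n)]$ converge in $\mathbb{CP}^{d-1}$, and $\mathbf z_n^{-\mathfrak v}\nabla_{\log}H(\mathbf z_n)\to\mathbf 0$. Let $(\mathbf w_n)$ be a sequence in $(\mathbb C^*)^d$ such that $(\tau_N(\mathbf w_n))$ is a subsequence of $(\mathbf z_n)$ and $\mathbf w_n$ converges to a point $Z\in\mathbb C^d$. Suppose that $\nabla\overline H(Z)\neq\mathbf 0$ and that the Jacobian of $\nabla_{\log}\overline H$ on the hypersurface $V(\overline H)$ at $Z$, i.e. the derivative of $\nabla_{\log}\overline H$ at $Z$ restricted to $T_ZV(\overline H)=\{\mathbf u : d\overline H_Z(\mathbf u)=0\}$, has full rank $d-1$. Then the set of directions $R\in\mathbb{CP}^{d-1}$ in which $p$ is a CPAI is a linear subvariety of codimension $1$ in $\mathbb{CP}^{d-1}$, and it contains all directions parallel to $F$. 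-/

import Mathlib

open Filter Topology
open scoped Pointwise Matrix LinearAlgebra.Projectivization

noncomputable section

/-- The quotient topology on the projectivization of a complex topological vector space
(for `ℂⁿ` this is the usual topology of `ℂℙⁿ⁻¹`). -/
instance projectivizationTopology (V : Type*) [AddCommGroup V] [Module ℂ V]
    [TopologicalSpace V] : TopologicalSpace (ℙ ℂ V) :=
  TopologicalSpace.coinduced (Projectivization.mk' ℂ) inferInstance

/-! ### Laurent polynomials, Newton polytopes, faces -/

/-- Laurent polynomials in `d` variables over `ℂ`: finite sums of `c_m z^m`, `m ∈ ℤᵈ`. -/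
abbrev LaurentPoly (d : ℕ) : Type := AddMonoidAlgebra ℂ (Fin d → ℤ)

/-- The value `∑ c_m z^m` of a Laurent polynomial. -/
def evalLaurent {d : ℕ} (H : LaurentPoly d) (z : Fin d → ℂ) : ℂ :=
  H.coeff.sum fun m c => c * ∏ i, z i ^ m i

/-- The inclusion `ℤᵈ ⊆ ℝᵈ`. -/
def latticeToReal {d : ℕ} (m : Fin d → ℤ) : Fin d → ℝ := fun i => (m i : ℝ)

/-- The set of exponents in `ℤᵈ` of the lattice points of a set `Q ⊆ ℝᵈ`. -/
def latticePoints {d : ℕ} (Q : Set (Fin d → ℝ)) : Set (Fin d → ℤ) :=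
  {m | latticeToReal m ∈ Q}

/-- The Newton polytope: the convex hull of the exponent vectors. -/
def newtonPolytope {d : ℕ} (H : LaurentPoly d) : Set (Fin d → ℝ) :=
  convexHull ℝ (latticeToReal '' (H.coeff.support : Set (Fin d → ℤ)))

/-- The enlarged Newton polytope `Q = κ 𝒫`. -/
def enlargedPolytope {d : ℕ} (H : LaurentPoly d) (κ : ℕ) : Set (Fin d → ℝ) :=
  (κ : ℝ) • newtonPolytope H

/-- A polytope is normal if, for every `k ≥ 1`, every lattice point of `kQ` is a sum of exactly
`k` lattice points of `Q`. -/
def IsNormalPolytope {d : ℕ} (Q : Set (Fin d → ℝ)) : Prop :=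
  ∀ k : ℕ, 1 ≤ k → ∀ m ∈ latticePoints ((k : ℝ) • Q),
    ∃ f : Fin k → latticePoints Q, ∑ i, (f i : Fin d → ℤ) = m

/-- Nonempty faces of a polytope (the polytope itself included): the sets on which a linear
functional attains its maximum. -/
def IsFace {d : ℕ} (P G : Set (Fin d → ℝ)) : Prop :=
  G.Nonempty ∧ IsExposed ℝ P G

/-- `L_F`, the linear span of the differences of points of `F`. -/
abbrev directionSpace {d : ℕ} (F : Set (Fin d → ℝ)) : Submodule ℝ (Fin d → ℝ) :=
  vectorSpan ℝ F

/-- Facets: faces of codimension one in `ℝᵈ`. -/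
def IsFacet {d : ℕ} (P G : Set (Fin d → ℝ)) : Prop :=
  IsFace P G ∧ Module.finrank ℝ (directionSpace G) + 1 = d

/-- `n` is a nonzero integer vector that is normal to `G` and points from `G` into `P`. -/
def IsInwardNormal {d : ℕ} (P G : Set (Fin d → ℝ)) (n : Fin d → ℤ) : Prop :=
  n ≠ 0 ∧ (∀ x ∈ directionSpace G, latticeToReal n ⬝ᵥ x = 0) ∧
    ∀ x ∈ P, ∀ y ∈ G, 0 ≤ latticeToReal n ⬝ᵥ (x - y)

/-- The inward-pointing normal of a facet: the one of minimal modulus among the nonzero integer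
vectors that are normal to the facet and point into `P`. -/
def IsMinimalInwardNormal {d : ℕ} (P G : Set (Fin d → ℝ)) (n : Fin d → ℤ) : Prop :=
  IsInwardNormal P G n ∧ ∀ n', IsInwardNormal P G n' → n ⬝ᵥ n ≤ n' ⬝ᵥ n'

/-- `σ_F`, the nonnegative linear span of the preimage in `ℝᵈ` of the image of `Q - v`
in `ℝᵈ / L_F`, where `v` is a vertex of `F`. -/
def faceCone {d : ℕ} (Q F : Set (Fin d → ℝ)) (v : Fin d → ℝ) :
    PointedCone ℝ (Fin d → ℝ) :=
  PointedCone.hull ℝ ((directionSpace F).mkQ ⁻¹' ((directionSpace F).mkQ '' ((· - v) '' Q)))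

/-- `σ_F / L_F`, the image of `σ_F` in `ℝᵈ / L_F`. -/
def quotientFaceCone {d : ℕ} (Q F : Set (Fin d → ℝ)) (v : Fin d → ℝ) :
    PointedCone ℝ ((Fin d → ℝ) ⧸ directionSpace F) :=
  PointedCone.map (directionSpace F).mkQ (faceCone Q F v)

/-! ### The toric compactification -/

/-- The Laurent monomial `z^m` on the torus `(ℂ*)ᵈ`. -/
def torusMonomial {d : ℕ} (m : Fin d → ℤ) (z : Fin d → ℂˣ) : ℂˣ := ∏ i, z i ^ m i

/-- The inclusion `(ℂ*)ᵈ ⊆ ℂᵈ`. -/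
def torusToAffine {d : ℕ} (z : Fin d → ℂˣ) : Fin d → ℂ := fun i => (z i : ℂ)

/-- The homogeneous coordinates of `Φ(z)`. -/
def toricCoords {d : ℕ} (Q : Set (Fin d → ℝ)) (z : Fin d → ℂˣ) : latticePoints Q → ℂ :=
  fun m => (torusMonomial (m : Fin d → ℤ) z : ℂ)

theorem toricCoords_ne_zero {d : ℕ} (Q : Set (Fin d → ℝ)) [h : Nonempty (latticePoints Q)]
    (z : Fin d → ℂˣ) : toricCoords Q z ≠ 0 := by
  obtain ⟨m⟩ := h
  intro h0
  exact (torusMonomial (m : Fin d → ℤ) z).ne_zero (congrFun h0 m)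

instance enlargedPolytope_nonempty {d : ℕ} (H : LaurentPoly d) [hH : NeZero H] (κ : ℕ) :
    Nonempty (latticePoints (enlargedPolytope H κ)) := by
  have h1 : H.coeff ≠ 0 := fun h => hH.out (AddMonoidAlgebra.coeff_eq_zero.1 h)
  obtain ⟨m, hm⟩ := Finsupp.support_nonempty_iff.2 h1
  refine ⟨⟨(κ : ℤ) • m, latticeToReal m, subset_convexHull ℝ _ ⟨m, hm, rfl⟩, ?_⟩⟩
  funext i
  simp [latticeToReal]

/-- The map `Φ : (ℂ*)ᵈ → ℂℙˢ⁻¹`, `z ↦ [z^{m₁} : ⋯ : z^{m_s}]`, where `m₁, …, m_s` are the lattice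
points of `Q = κ 𝒫`. -/
def toricMap {d : ℕ} (H : LaurentPoly d) [NeZero H] (κ : ℕ) (z : Fin d → ℂˣ) :
    ℙ ℂ (latticePoints (enlargedPolytope H κ) → ℂ) :=
  Projectivization.mk ℂ (toricCoords (enlargedPolytope H κ) z) (toricCoords_ne_zero _ z)

/-- `X_A`, the closure of the image of `Φ`. -/
def toricCompactification {d : ℕ} (H : LaurentPoly d) [NeZero H] (κ : ℕ) :
    Set (ℙ ℂ (latticePoints (enlargedPolytope H κ) → ℂ)) :=
  closure (Set.range (toricMap H κ))

/-- `X⁰(F)`: the points of `X_A` whose nonzero homogeneous coordinates are precisely those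
belonging to lattice points in `F`. -/
def faceAtInfinityInterior {d : ℕ} (H : LaurentPoly d) [NeZero H] (κ : ℕ)
    (F : Set (Fin d → ℝ)) : Set (ℙ ℂ (latticePoints (enlargedPolytope H κ) → ℂ)) :=
  {p ∈ toricCompactification H κ | ∀ m, p.rep m ≠ 0 ↔ latticeToReal (m : Fin d → ℤ) ∈ F}

/-! ### Log-gradients and critical points at infinity -/

/-- The gradient `(∂f/∂z₁, …, ∂f/∂z_d)`. -/
def grad {d : ℕ} (f : (Fin d → ℂ) → ℂ) (z : Fin d → ℂ) : Fin d → ℂ :=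
  fun j => fderiv ℂ f z (Pi.single j 1)

/-- The log-gradient `(z₁ ∂f/∂z₁, …, z_d ∂f/∂z_d)`. -/
def logGrad {d : ℕ} (f : (Fin d → ℂ) → ℂ) (z : Fin d → ℂ) : Fin d → ℂ :=
  fun j => z j * grad f z j

/-- `V* = V(H) ∩ (ℂ*)ᵈ`. -/
def torusVariety {d : ℕ} (H : LaurentPoly d) : Set (Fin d → ℂˣ) :=
  {z | evalLaurent H (torusToAffine z) = 0}

/-- `V*` is smooth: the gradient of `H` vanishes nowhere on `V*`. -/
def IsSmoothTorusVariety {d : ℕ} (H : LaurentPoly d) : Prop :=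
  ∀ z ∈ torusVariety H, grad (evalLaurent H) (torusToAffine z) ≠ 0

/-- The relation between points `z` of the smooth hypersurface `V*` and directions
`r ∈ ℂℙᵈ⁻¹`: the direction `r` is that of the log-normal to `V*` at `z`. -/
def IsLogNormalPair {d : ℕ} (H : LaurentPoly d) (z : Fin d → ℂˣ) (r : ℙ ℂ (Fin d → ℂ)) : Prop :=
  z ∈ torusVariety H ∧
    ∃ h : logGrad (evalLaurent H) (torusToAffine z) ≠ 0, r = Projectivization.mk ℂ _ h

/-- `p` is a critical point at infinity in direction `R`: it is not a point of (the embedded copy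
of) `V*`, and `(p, R)` is the limit of a sequence of points of `V*` with their log-normal
directions. -/
def IsCPAI {d : ℕ} (H : LaurentPoly d) [NeZero H] (κ : ℕ)
    (p : ℙ ℂ (latticePoints (enlargedPolytope H κ) → ℂ)) (R : ℙ ℂ (Fin d → ℂ)) : Prop :=
  p ∉ toricMap H κ '' torusVariety H ∧
    ∃ (z : ℕ → Fin d → ℂˣ) (r : ℕ → ℙ ℂ (Fin d → ℂ)),
      (∀ n, IsLogNormalPair H (z n) (r n)) ∧
      Tendsto (fun n => toricMap H κ (z n)) atTop (𝓝 p) ∧ Tendsto r atTop (𝓝 R)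

/-- The direction `R ∈ ℂℙᵈ⁻¹` is parallel to `F`: it lies in the complex span of `L_F`. -/
def IsParallelTo {d : ℕ} (R : ℙ ℂ (Fin d → ℂ)) (F : Set (Fin d → ℝ)) : Prop :=
  R.submodule ≤ Submodule.span ℂ ((fun (x : Fin d → ℝ) (i : Fin d) => (x i : ℂ)) ''
    (directionSpace F : Set (Fin d → ℝ)))

/-- A linear subvariety of codimension one in `ℂℙᵈ⁻¹`. -/
def IsProjectiveHyperplane {d : ℕ} (S : Set (ℙ ℂ (Fin d → ℂ))) : Prop :=
  ∃ W : Submodule ℂ (Fin d → ℂ), Module.finrank ℂ W + 1 = d ∧ S = {R | R.submodule ≤ W}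

/-- The rank at `Z` of the Jacobian of the log-gradient of `f` on the hypersurface `V(f)`: the
rank of the restriction of the derivative of `∇_log f` at `Z` to the tangent space
`{v : df_Z(v) = 0}`. -/
def logGradJacobianRank {d : ℕ} (f : (Fin d → ℂ) → ℂ) (Z : Fin d → ℂ) : ℕ :=
  Module.finrank ℂ (Submodule.map (fderiv ℂ (logGrad f) Z : (Fin d → ℂ) →ₗ[ℂ] (Fin d → ℂ))
    (LinearMap.ker (fderiv ℂ f Z : (Fin d → ℂ) →ₗ[ℂ] ℂ)))

/-! ### Monomial transformations -/

/-- The monomial transformation `τ_N(w)_i = ∏_j w_j ^ N_ij` of the torus. -/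
def monomialMap {d : ℕ} (N : Matrix (Fin d) (Fin d) ℤ) (w : Fin d → ℂˣ) : Fin d → ℂˣ :=
  fun i => torusMonomial (N i) w

/-- The induced map `τ_N^*` on Laurent polynomials, `z^m ↦ w^{Nᵀ m}`. -/
def monomialPullback {d : ℕ} (N : Matrix (Fin d) (Fin d) ℤ) (H : LaurentPoly d) :
    LaurentPoly d :=
  AddMonoidAlgebra.mapDomain (fun m => Nᵀ *ᵥ m) H

/-- `H̄ = τ_N^*(z^{-𝔳} H)`. -/
def transformedPoly {d : ℕ} (N : Matrix (Fin d) (Fin d) ℤ) (v : Fin d → ℤ) (H : LaurentPoly d) :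
    LaurentPoly d :=
  monomialPullback N (AddMonoidAlgebra.single (-v) 1 * H)

end

/-! The substitution `τ_N` turns the end of `V*` near `p` into an honest hypersurface germ. Write
`h` for the evaluation of `transformedPoly N v H`. On `V*` the log-gradients of `h` and of `H`
differ by the factor `z^{-v}` and by the linear automorphism `Nᵀ` (`logGrad_transformedPoly_torus`),
so directions can be computed for `h` and carried back. The decay hypothesis says that `∇_log h`
vanishes at `Z`, while `V(h)` is smooth there. Let `T` be its tangent space and `J` the derivative
of `∇_log h`, which is injective on `T` by the rank condition.

To first order `∇_log h (Z + s t) ≈ s J t`. Hence every limit direction along a sequence tending to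
`Z` is some `J t` with `t ∈ T` (`exists_limit_direction`). Conversely, each nonzero `J t` arises
from points of the torus, after a perturbation off the coordinate hyperplanes (`exists_torus_seq`).
The directions are therefore the projectivization of `W = N^{-T} J(T)`, of dimension `d - 1`.

It must also be shown that all sequences tending to `p` are seen at the one point `Z`. Normality
makes monomials with exponents in `L_F` have nonzero limits depending on `p` alone
(`mem_closure_of_mem_directionSpace`). Simpliciality provides, for each of the last `k` coordinates,
a lattice point forcing it to `0` (`exists_lattice_ray`). Lifts thus accumulate only at points with
the same `L_F`-monomials as `Z`, and divisibility of `ℂˣ` yields an element of `ker τ_N` moving such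
a point to `Z` (`exists_lift_tendsto`).

Finally, `Nᵀ` maps `L_F ⊗ ℂ` into the vectors supported where `Z` is nonzero. These are tangent, and
`J` permutes them bijectively, so they lie in `J(T)` (`mem_map_fderiv_logGrad`). -/

noncomputable section

/-! ### Convergence in projective space -/

theorem tendsto_projectivization_mk {V α : Type*} [AddCommGroup V] [Module ℂ V]
    [TopologicalSpace V] {l : Filter α} {f : α → V} {x : V} (hf : ∀ a, f a ≠ 0) (hx : x ≠ 0)
    (h : Tendsto f l (𝓝 x)) :
    Tendsto (fun a => Projectivization.mk ℂ (f a) (hf a)) l (𝓝 (Projectivization.mk ℂ x hx)) := by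
  have hc : Continuous (Projectivization.mk' ℂ : { v : V // v ≠ 0 } → ℙ ℂ V) :=
    continuous_coinduced_rng
  have h1 : Tendsto (fun a => (⟨f a, hf a⟩ : { v : V // v ≠ 0 })) l (𝓝 ⟨x, hx⟩) :=
    tendsto_subtype_rng.2 h
  exact (hc.tendsto _).comp h1

theorem tendsto_projectivization_mk_of_smul {V α : Type*} [AddCommGroup V] [Module ℂ V]
    [TopologicalSpace V] [T1Space V] {l : Filter α} {f : α → V} {s : α → ℂ} {x : V}
    (hf : ∀ a, f a ≠ 0) (hx : x ≠ 0) (h : Tendsto (fun a => s a • f a) l (𝓝 x)) :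
    Tendsto (fun a => Projectivization.mk ℂ (f a) (hf a)) l (𝓝 (Projectivization.mk ℂ x hx)) := by
  have hs : ∀ᶠ a in l, s a ≠ 0 := by
    filter_upwards [h.eventually (isOpen_ne.eventually_mem hx)] with a ha h0
    exact ha (by simp [h0])
  -- A scalar may vanish at some `a`, but not eventually; the default value `1` keeps every vector
  -- nonzero without changing the limit.
  have h1 := tendsto_projectivization_mk (f := fun a => (if s a = 0 then 1 else s a) • f a)
    (fun a => by split_ifs with h0 <;> simp [hf, h0]) hx
    (h.congr' (by filter_upwards [hs] with a ha; simp [ha]))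
  refine h1.congr fun a => ?_
  rw [Projectivization.mk_eq_mk_iff']
  exact ⟨_, rfl⟩

/-- Coordinate ratios do not depend on the representative, and the chart where the denominator is
nonzero is open in the coinduced topology. This also supplies uniqueness of projective limits below.
-/
theorem tendsto_ratio_of_tendsto_projectivization {ι α : Type*} {l : Filter α}
    {f : α → ι → ℂ} (hf : ∀ a, f a ≠ 0) {x : ι → ℂ} (hx : x ≠ 0)
    (h : Tendsto (fun a => Projectivization.mk ℂ (f a) (hf a)) l (𝓝 (Projectivization.mk ℂ x hx)))
    {i : ι} (hi : x i ≠ 0) (j : ι) :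
    Tendsto (fun a => f a j / f a i) l (𝓝 (x j / x i)) := by
  rw [tendsto_nhds]
  intro O hO hxO
  let S : Set (ℙ ℂ (ι → ℂ)) := {q | q.rep i ≠ 0 ∧ q.rep j / q.rep i ∈ O}
  have hmem : ∀ (v : ι → ℂ) (hv : v ≠ 0),
      Projectivization.mk ℂ v hv ∈ S ↔ v i ≠ 0 ∧ v j / v i ∈ O := by
    intro v hv
    obtain ⟨a, ha⟩ := Projectivization.exists_smul_eq_mk_rep ℂ v hv
    have ha0 : (a : ℂ) ≠ 0 := a.ne_zero
    have e : ∀ t, (Projectivization.mk ℂ v hv).rep t = a * v t := by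
      intro t; rw [← ha]; rfl
    simp only [S, Set.mem_ofPred_eq, e, mul_div_mul_left _ _ ha0]
    simp [ha0]
  have hS : IsOpen S := by
    have : IsOpen ((Projectivization.mk' ℂ : { v : ι → ℂ // v ≠ 0 } → _) ⁻¹' S) := by
      have h1 : ((Projectivization.mk' ℂ : { v : ι → ℂ // v ≠ 0 } → _) ⁻¹' S)
          = Subtype.val ⁻¹' {v : ι → ℂ | v i ≠ 0 ∧ v j / v i ∈ O} := by
        ext ⟨v, hv⟩
        exact hmem v hv
      rw [h1]
      refine IsOpen.preimage continuous_subtype_val ?_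
      rw [isOpen_iff_mem_nhds]
      rintro v ⟨hv, hvO⟩
      have c : ContinuousAt (fun v : ι → ℂ => v j / v i) v :=
        (continuous_apply j).continuousAt.div (continuous_apply i).continuousAt hv
      filter_upwards [(continuous_apply i).continuousAt.eventually_ne hv,
        c.eventually (hO.mem_nhds hvO)] with u h1 h2 using ⟨h1, h2⟩
    exact isOpen_coinduced.2 this
  have := h.eventually (hS.mem_nhds ((hmem x hx).2 ⟨hi, hxO⟩))
  filter_upwards [this] with a ha
  exact ((hmem _ _).1 ha).2

/-! ### Hypersurfaces near a smooth point -/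

/-- The implicit function theorem parametrizes the level set by the kernel of the derivative; the
curve is the image of the line through `t`. -/
theorem exists_curve_of_mem_ker {E : Type*} [NormedAddCommGroup E] [NormedSpace ℂ E]
    [CompleteSpace E] {h : E → ℂ} {h' : E →L[ℂ] ℂ} {y : E} (hh : HasStrictFDerivAt h h' y)
    (h0 : h' ≠ 0) {t : E} (ht : h' t = 0) :
    ∃ c : ℂ → E, c 0 = y ∧ HasDerivAt c t 0 ∧ ∀ᶠ s in 𝓝 0, h (c s) = h y := by
  have hr : h'.range = ⊤ := by
    apply LinearMap.range_eq_top.2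
    apply LinearMap.surjective
    exact fun h => h0 (by ext x; exact congrArg (fun f => f x) h)
  let T : h'.ker := ⟨t, ht⟩
  have hT : HasDerivAt (fun s : ℂ => s • T) T 0 := by
    simpa using (hasDerivAt_id (0 : ℂ)).smul_const T
  have h1 := (hh.to_implicitFunction hr).hasFDerivAt
  refine ⟨fun s => hh.implicitFunction h h' hr (h y) (s • T), by simp, ?_, ?_⟩
  · have h2 : HasFDerivAt (hh.implicitFunction h h' hr (h y)) h'.ker.subtypeL ((0 : ℂ) • T) := by
      simpa using h1
    exact h2.comp_hasDerivAt (0 : ℂ) hT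
  · have h2 := hh.map_implicitFunction_eq hr
    have h3 : Tendsto (fun s : ℂ => (h y, s • T)) (𝓝 0) (𝓝 (h y, 0)) := by
      have : Tendsto (fun s : ℂ => s • T) (𝓝 0) (𝓝 0) := by
        simpa using hT.continuousAt.tendsto
      exact tendsto_const_nhds.prodMk_nhds this
    exact h3.eventually h2

theorem fderiv_apply_eq_sum_grad {d : ℕ} (h : (Fin d → ℂ) → ℂ) (y t : Fin d → ℂ) :
    fderiv ℂ h y t = ∑ j, t j * grad h y j := by
  conv_lhs => rw [← Finset.univ_sum_single t]
  rw [map_sum]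
  refine Finset.sum_congr rfl fun j _ => ?_
  rw [show (Pi.single j (t j) : Fin d → ℂ) = t j • Pi.single j (1 : ℂ) by
    rw [← Pi.single_smul]; simp]
  simp [grad]

theorem analyticAt_grad {d : ℕ} {h : (Fin d → ℂ) → ℂ} {y : Fin d → ℂ} (hh : AnalyticAt ℂ h y)
    (j : Fin d) : AnalyticAt ℂ (fun x => grad h x j) y := by
  exact ((ContinuousLinearMap.apply ℂ ℂ (Pi.single j (1 : ℂ) : Fin d → ℂ)).analyticAt _).comp
    hh.fderiv

theorem analyticAt_logGrad {d : ℕ} {h : (Fin d → ℂ) → ℂ} {y : Fin d → ℂ}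
    (hh : AnalyticAt ℂ h y) : AnalyticAt ℂ (logGrad h) y := by
  refine analyticAt_pi_iff.2 fun j => ?_
  exact ((ContinuousLinearMap.proj (R := ℂ) (φ := fun _ : Fin d => ℂ) j).analyticAt y).mul
    (analyticAt_grad hh j)

/-- A nonzero log-gradient means that the hypersurface is not tangent to the coordinate hyperplanes
through `y` in a way that traps it: some tangent vector leaves all of them at once. -/
theorem frequently_ne_zero_of_logGrad_ne_zero {d : ℕ} {h : (Fin d → ℂ) → ℂ} {y : Fin d → ℂ}
    (hh : AnalyticAt ℂ h y) (h0 : h y = 0) (hG : logGrad h y ≠ 0) :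
    ∃ᶠ x in 𝓝 y, h x = 0 ∧ ∀ i, x i ≠ 0 := by
  obtain ⟨i, hi⟩ := Function.ne_iff.1 hG
  have hyi : y i ≠ 0 := fun h => hi (by simp [logGrad, h])
  have hgi : grad h y i ≠ 0 := fun h => hi (by simp [logGrad, h])
  have hd : fderiv ℂ h y ≠ 0 := fun h => hgi (by simp [grad, h])
  -- All coordinates but the `i`-th move with speed `1`; the `i`-th is solved for tangency and is
  -- free to do anything because `y i ≠ 0`.
  let t : Fin d → ℂ := Function.update (fun _ => 1) i
    (-(∑ j ∈ Finset.univ.erase i, grad h y j) / grad h y i)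
  have ht : fderiv ℂ h y t = 0 := by
    rw [fderiv_apply_eq_sum_grad, ← Finset.add_sum_erase _ _ (Finset.mem_univ i),
      Finset.sum_congr rfl (g := fun j => grad h y j)]
    · simp only [t, Function.update_self]
      field_simp
      ring
    · intro j hj
      simp [t, Function.update_of_ne (Finset.ne_of_mem_erase hj)]
  obtain ⟨c, c0, hc, hch⟩ := exists_curve_of_mem_ker hh.hasStrictFDerivAt hd ht
  have hcy : Tendsto c (𝓝[≠] 0) (𝓝 y) := by
    have := hc.continuousAt.tendsto
    rw [c0] at this
    exact this.mono_left nhdsWithin_le_nhds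
  have hne : ∀ j, ∀ᶠ s in 𝓝[≠] (0 : ℂ), c s j ≠ 0 := by
    intro j
    by_cases hj : y j = 0
    · have hji : j ≠ i := fun h => hyi (h ▸ hj)
      have h1 : HasDerivAt (fun s => c s j) (t j) 0 := hasDerivAt_pi.1 hc j
      have h2 : t j ≠ 0 := by simp [t, Function.update_of_ne hji]
      have := h1.eventually_ne (c := 0) h2
      exact this
    · exact ((continuous_apply j).continuousAt.tendsto.comp hcy).eventually_ne hj
  refine hcy.frequently (Eventually.frequently ?_)
  filter_upwards [eventually_all.2 hne, hch.filter_mono nhdsWithin_le_nhds] with s h1 h2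
  exact ⟨h2.trans h0, h1⟩

/-- Along a curve in the hypersurface with velocity `t`, the log-gradient divided by the parameter
tends to `J t`. The chosen point of the curve may lie on coordinate hyperplanes, but its
log-gradient is nonzero, so a nearby torus point of the hypersurface still satisfies the open
conditions. -/
theorem exists_torus_point_near {d : ℕ} {h : (Fin d → ℂ) → ℂ} {Z t : Fin d → ℂ}
    (hh : AnalyticAt ℂ h Z) (h0 : h Z = 0) (hG : logGrad h Z = 0)
    (hd : fderiv ℂ h Z ≠ 0) (ht : fderiv ℂ h Z t = 0) (hJ : fderiv ℂ (logGrad h) Z t ≠ 0)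
    {δ : ℝ} (hδ : 0 < δ) :
    ∃ (x : Fin d → ℂ) (s : ℂ), h x = 0 ∧ (∀ i, x i ≠ 0) ∧ logGrad h x ≠ 0 ∧ dist x Z < δ ∧
      dist (s • logGrad h x) (fderiv ℂ (logGrad h) Z t) < δ := by
  obtain ⟨c, c0, hc, hch⟩ := exists_curve_of_mem_ker hh.hasStrictFDerivAt hd ht
  have hcZ : Tendsto c (𝓝[≠] 0) (𝓝 Z) := by
    have := hc.continuousAt.tendsto
    rw [c0] at this
    exact this.mono_left nhdsWithin_le_nhds
  have hGd : HasDerivAt (logGrad h ∘ c) (fderiv ℂ (logGrad h) Z t) 0 := by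
    refine HasFDerivAt.comp_hasDerivAt (0 : ℂ) ?_ hc
    rw [c0]
    exact (analyticAt_logGrad hh).differentiableAt.hasFDerivAt
  have hsl := hasDerivAt_iff_tendsto_slope.1 hGd
  have hne : ∀ᶠ s in 𝓝[≠] (0 : ℂ), (logGrad h ∘ c) s ≠ 0 := hGd.eventually_ne hJ
  obtain ⟨s, h1, h2, h3, h4, h5⟩ := ((hsl.eventually (Metric.ball_mem_nhds _ hδ)).and
    ((hcZ.eventually (Metric.ball_mem_nhds _ hδ)).and
    ((hcZ.eventually hh.eventually_analyticAt).and
    (hne.and (hch.filter_mono nhdsWithin_le_nhds))))).exists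
  have h1' : dist (s⁻¹ • logGrad h (c s)) (fderiv ℂ (logGrad h) Z t) < δ := by
    simpa [slope, c0, hG] using h1
  have hcont := (analyticAt_logGrad h3).continuousAt
  have e1 : ∀ᶠ x in 𝓝 (c s), dist (s⁻¹ • logGrad h x) (fderiv ℂ (logGrad h) Z t) < δ :=
    ((hcont.const_smul s⁻¹).dist continuousAt_const).eventually_lt_const h1'
  have e2 : ∀ᶠ x in 𝓝 (c s), dist x Z < δ :=
    (continuousAt_id.dist continuousAt_const).eventually_lt_const h2
  have e3 : ∀ᶠ x in 𝓝 (c s), logGrad h x ≠ 0 := hcont.eventually_ne h4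
  obtain ⟨x, ⟨hx, hx'⟩, hx1, hx2, hx3⟩ := ((frequently_ne_zero_of_logGrad_ne_zero h3
    (h5.trans h0) h4).and_eventually (e1.and (e2.and e3))).exists
  exact ⟨x, s⁻¹, hx, hx', hx3, hx2, hx1⟩

theorem exists_torus_seq {d : ℕ} {h : (Fin d → ℂ) → ℂ} {Z t : Fin d → ℂ}
    (hh : AnalyticAt ℂ h Z) (h0 : h Z = 0) (hG : logGrad h Z = 0)
    (hd : fderiv ℂ h Z ≠ 0) (ht : fderiv ℂ h Z t = 0) (hJ : fderiv ℂ (logGrad h) Z t ≠ 0) :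
    ∃ (x : ℕ → Fin d → ℂˣ) (s : ℕ → ℂ), (∀ n, h (torusToAffine (x n)) = 0) ∧
      (∀ n, logGrad h (torusToAffine (x n)) ≠ 0) ∧
      Tendsto (fun n => torusToAffine (x n)) atTop (𝓝 Z) ∧
      Tendsto (fun n => s n • logGrad h (torusToAffine (x n))) atTop
        (𝓝 (fderiv ℂ (logGrad h) Z t)) := by
  choose x s h1 h2 h3 h4 h5 using fun n : ℕ =>
    exists_torus_point_near hh h0 hG hd ht hJ (Nat.one_div_pos_of_nat (α := ℝ) (n := n))
  have hx : ∀ n, torusToAffine (fun i => Units.mk0 (x n i) (h2 n i)) = x n := fun n => rfl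
  refine ⟨fun n i => Units.mk0 (x n i) (h2 n i), s, fun n => ?_, fun n => ?_, ?_, ?_⟩
  · rw [hx, h1]
  · rw [hx]; exact h3 n
  · simp only [hx]
    rw [tendsto_iff_dist_tendsto_zero]
    exact squeeze_zero (fun _ => dist_nonneg) (fun n => (h4 n).le)
      tendsto_one_div_add_atTop_nhds_zero_nat
  · simp only [hx]
    rw [tendsto_iff_dist_tendsto_zero]
    exact squeeze_zero (fun _ => dist_nonneg) (fun n => (h5 n).le)
      tendsto_one_div_add_atTop_nhds_zero_nat

/-- Normalized secants from `Z` subconverge to a unit vector `t`. Applying the same rescaling to `h`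
shows that `t` is tangent, and to `∇_log h` that the limit is `J t`, nonzero by injectivity. -/
theorem exists_limit_direction {d : ℕ} {h : (Fin d → ℂ) → ℂ} {Z : Fin d → ℂ}
    (hh : AnalyticAt ℂ h Z) (h0 : h Z = 0) (hG : logGrad h Z = 0)
    (hJ : ∀ t, fderiv ℂ h Z t = 0 → fderiv ℂ (logGrad h) Z t = 0 → t = 0)
    {w : ℕ → Fin d → ℂ} (hw : Tendsto w atTop (𝓝 Z)) (hwZ : ∀ n, w n ≠ Z)
    (hw0 : ∀ n, h (w n) = 0) :
    ∃ (t : Fin d → ℂ) (φ : ℕ → ℕ) (s : ℕ → ℂ), StrictMono φ ∧ fderiv ℂ h Z t = 0 ∧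
      fderiv ℂ (logGrad h) Z t ≠ 0 ∧
      Tendsto (fun n => s n • logGrad h (w (φ n))) atTop (𝓝 (fderiv ℂ (logGrad h) Z t)) := by
  let c : ℕ → ℂ := fun n => ((‖w n - Z‖⁻¹ : ℝ) : ℂ)
  have hpos : ∀ n, 0 < ‖w n - Z‖ := fun n => norm_pos_iff.2 (sub_ne_zero.2 (hwZ n))
  have hsph : ∀ n, c n • (w n - Z) ∈ Metric.sphere (0 : Fin d → ℂ) 1 := by
    intro n
    rw [mem_sphere_zero_iff_norm, norm_smul, Complex.norm_real, norm_inv, norm_norm,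
      inv_mul_cancel₀ (hpos n).ne']
  obtain ⟨t, ht, φ, hφ, hlim⟩ := (isCompact_sphere (0 : Fin d → ℂ) 1).tendsto_subseq hsph
  have hdZ : ∀ {F : Type} [NormedAddCommGroup F] [NormedSpace ℂ F] {f : (Fin d → ℂ) → F},
      DifferentiableAt ℂ f Z → f Z = 0 →
      Tendsto (fun n => c (φ n) • f (w (φ n))) atTop (𝓝 (fderiv ℂ f Z t)) := by
    intro F _ _ f hf hf0
    have h1 := (hasFDerivWithinAt_univ.2 hf.hasFDerivAt).lim (d := fun n => w (φ n) - Z)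
      (tendsto_sub_nhds_zero_iff.2 (hw.comp hφ.tendsto_atTop))
      (Eventually.of_forall fun _ => Set.mem_univ _) hlim
    simpa [hf0] using h1
  have ht0 : t ≠ 0 := by
    rintro rfl
    simp at ht
  have hht : fderiv ℂ h Z t = 0 := by
    have h1 := hdZ hh.differentiableAt h0
    simp only [hw0, smul_zero] at h1
    exact tendsto_nhds_unique h1 tendsto_const_nhds
  exact ⟨t, φ, fun n => c (φ n), hφ, hht, fun h => ht0 (hJ t hht h),
    hdZ (analyticAt_logGrad hh).differentiableAt hG⟩
-- The Jacobian of the log-gradient.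
-- Product rule. Where `Z j = 0` only the second term survives, which makes the Jacobian preserve
-- the vectors supported on the nonzero coordinates of `Z`.
theorem fderiv_logGrad_apply {d : ℕ} {h : (Fin d → ℂ) → ℂ} {Z : Fin d → ℂ}
    (hh : AnalyticAt ℂ h Z) (t : Fin d → ℂ) (j : Fin d) :
    fderiv ℂ (logGrad h) Z t j =
      Z j * fderiv ℂ (fun x => grad h x j) Z t + grad h Z j * t j := by
  have h1 : HasFDerivAt (fun x : Fin d → ℂ => x j)
      (ContinuousLinearMap.proj (R := ℂ) (φ := fun _ : Fin d => ℂ) j) Z :=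
    (ContinuousLinearMap.proj (R := ℂ) (φ := fun _ : Fin d => ℂ) j).hasFDerivAt
  have h2 := (h1.mul (analyticAt_grad hh j).differentiableAt.hasFDerivAt).fderiv
  have h3 := hasFDerivAt_pi'.1 (analyticAt_logGrad hh).differentiableAt.hasFDerivAt j
  have h4 := h3.fderiv
  have h5 : fderiv ℂ (fun x => logGrad h x j) Z t = fderiv ℂ (logGrad h) Z t j := by
    rw [h4]; rfl
  rw [← h5]
  change fderiv ℂ ((fun x : Fin d → ℂ => x j) * fun x => grad h x j) Z t = _
  rw [h2]
  simp

theorem finrank_ker_of_ne_zero {d : ℕ} {f : (Fin d → ℂ) →L[ℂ] ℂ} (hf : f ≠ 0) :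
    Module.finrank ℂ (LinearMap.ker (f : (Fin d → ℂ) →ₗ[ℂ] ℂ)) + 1 = d := by
  have h1 := LinearMap.finrank_range_add_finrank_ker (f : (Fin d → ℂ) →ₗ[ℂ] ℂ)
  have h2 : LinearMap.range (f : (Fin d → ℂ) →ₗ[ℂ] ℂ) = ⊤ := by
    apply LinearMap.range_eq_top.2
    apply LinearMap.surjective
    exact fun h => hf (by ext x; exact LinearMap.congr_fun h _)
  rw [h2, finrank_top] at h1
  simp at h1
  omega

theorem eq_zero_of_finrank_map_eq {V W : Type*} [AddCommGroup V] [Module ℂ V]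
    [AddCommGroup W] [Module ℂ W] [FiniteDimensional ℂ V] {f : V →ₗ[ℂ] W} {S : Submodule ℂ V}
    (h : Module.finrank ℂ (S.map f) = Module.finrank ℂ S) {t : V} (ht : t ∈ S) (hf : f t = 0) :
    t = 0 := by
  have h1 := LinearMap.finrank_range_add_finrank_ker (f.domRestrict S)
  rw [LinearMap.range_domRestrict, h] at h1
  have h2 : LinearMap.ker (f.domRestrict S) = ⊥ := Submodule.finrank_eq_zero.1 (by omega)
  have h3 : (⟨t, ht⟩ : S) ∈ LinearMap.ker (f.domRestrict S) := hf
  rw [h2] at h3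
  exact congrArg Subtype.val ((Submodule.mem_bot _).1 h3)

/-- Vectors supported on the nonvanishing coordinates of `Z` are values of the derivative of
the log-gradient on the tangent space. -/
theorem mem_map_fderiv_logGrad {d : ℕ} {h : (Fin d → ℂ) → ℂ} {Z : Fin d → ℂ}
    (hh : AnalyticAt ℂ h Z) (hG : logGrad h Z = 0)
    (hJ : ∀ t, fderiv ℂ h Z t = 0 → fderiv ℂ (logGrad h) Z t = 0 → t = 0)
    {x : Fin d → ℂ} (hx : ∀ j, Z j = 0 → x j = 0) :
    ∃ t, fderiv ℂ h Z t = 0 ∧ fderiv ℂ (logGrad h) Z t = x := by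
  let E : Submodule ℂ (Fin d → ℂ) :=
    { carrier := {x | ∀ j, Z j = 0 → x j = 0}
      add_mem' := fun ha hb j hj => by simp [ha j hj, hb j hj]
      zero_mem' := fun _ _ => rfl
      smul_mem' := fun c a ha j hj => by simp [ha j hj] }
  -- From `Z j * ∂_j h = 0`, the gradient vanishes in every coordinate where `Z` does not, so `E` is
  -- tangent.
  have hE : ∀ t ∈ E, fderiv ℂ h Z t = 0 := by
    intro t ht
    rw [fderiv_apply_eq_sum_grad]
    refine Finset.sum_eq_zero fun j _ => ?_
    by_cases hj : Z j = 0
    · rw [ht j hj, zero_mul]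
    · have := congrFun hG j
      simp only [logGrad, Pi.zero_apply, mul_eq_zero, hj, false_or] at this
      rw [this, mul_zero]
  have hEE : ∀ t ∈ E, (fderiv ℂ (logGrad h) Z : (Fin d → ℂ) →ₗ[ℂ] (Fin d → ℂ)) t ∈ E := by
    intro t ht j hj
    change fderiv ℂ (logGrad h) Z t j = 0
    rw [fderiv_logGrad_apply hh, hj, ht j hj]
    simp
  have hinj : Function.Injective
      ((fderiv ℂ (logGrad h) Z : (Fin d → ℂ) →ₗ[ℂ] (Fin d → ℂ)).restrict hEE) := by
    rw [injective_iff_map_eq_zero]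
    rintro ⟨t, ht⟩ h0
    exact Subtype.ext (hJ t (hE t ht) (congrArg Subtype.val h0))
  -- An injective endomorphism of the finite-dimensional space `E` is onto.
  obtain ⟨⟨t, ht⟩, h1⟩ := LinearMap.injective_iff_surjective.1 hinj ⟨x, hx⟩
  exact ⟨t, hE t ht, congrArg Subtype.val h1⟩

/-! ### Laurent monomials and log-gradients -/

theorem analyticAt_monomial {d : ℕ} {Z : Fin d → ℂ} {a : Fin d → ℤ}
    (ha : ∀ i, Z i ≠ 0 ∨ 0 ≤ a i) :
    AnalyticAt ℂ (fun z : Fin d → ℂ => ∏ i, z i ^ a i) Z := by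
  refine Finset.analyticAt_fun_prod _ fun i _ => ?_
  have h1 : AnalyticAt ℂ (fun z : Fin d → ℂ => z i) Z :=
    (ContinuousLinearMap.proj (R := ℂ) (φ := fun _ : Fin d => ℂ) i).analyticAt Z
  rcases ha i with h | h
  · exact h1.zpow h
  · exact h1.zpow_nonneg h

theorem analyticAt_evalLaurent {d : ℕ} {H : LaurentPoly d} {Z : Fin d → ℂ}
    (hZ : ∀ a ∈ H.coeff.support, ∀ i, Z i ≠ 0 ∨ 0 ≤ a i) :
    AnalyticAt ℂ (evalLaurent H) Z := by
  unfold evalLaurent Finsupp.sum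
  refine Finset.analyticAt_fun_sum _ fun a ha => ?_
  exact analyticAt_const.mul (analyticAt_monomial (hZ a ha))

theorem coe_torusMonomial {d : ℕ} (a : Fin d → ℤ) (z : Fin d → ℂˣ) :
    (torusMonomial a z : ℂ) = ∏ i, torusToAffine z i ^ a i := by
  simp [torusMonomial, torusToAffine]

theorem torusMonomial_add {d : ℕ} (a b : Fin d → ℤ) (z : Fin d → ℂˣ) :
    torusMonomial (a + b) z = torusMonomial a z * torusMonomial b z := by
  simp [torusMonomial, zpow_add, Finset.prod_mul_distrib]

theorem torusMonomial_zero {d : ℕ} (z : Fin d → ℂˣ) : torusMonomial 0 z = 1 := by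
  simp [torusMonomial]

theorem torusMonomial_neg {d : ℕ} (a : Fin d → ℤ) (z : Fin d → ℂˣ) :
    torusMonomial (-a) z = (torusMonomial a z)⁻¹ := by
  simp [torusMonomial]

theorem torusMonomial_sub {d : ℕ} (a b : Fin d → ℤ) (z : Fin d → ℂˣ) :
    torusMonomial (a - b) z = torusMonomial a z / torusMonomial b z := by
  rw [sub_eq_add_neg, torusMonomial_add, torusMonomial_neg, div_eq_mul_inv]

theorem torusMonomial_mul {d : ℕ} (a : Fin d → ℤ) (z z' : Fin d → ℂˣ) :
    torusMonomial a (z * z') = torusMonomial a z * torusMonomial a z' := by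
  simp [torusMonomial, mul_zpow, Finset.prod_mul_distrib]

theorem zpow_finsetSum {G ι : Type*} [CommGroup G] (g : G) (s : Finset ι) (f : ι → ℤ) :
    ∏ i ∈ s, g ^ f i = g ^ ∑ i ∈ s, f i := by
  classical
  induction s using Finset.induction_on with
  | empty => simp
  | insert a s ha ih => rw [Finset.prod_insert ha, Finset.sum_insert ha, ih, zpow_add]

theorem torusMonomial_monomialMap {d : ℕ} (N : Matrix (Fin d) (Fin d) ℤ) (a : Fin d → ℤ)
    (w : Fin d → ℂˣ) : torusMonomial a (monomialMap N w) = torusMonomial (Nᵀ *ᵥ a) w := by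
  simp only [torusMonomial, monomialMap, Matrix.mulVec, dotProduct, Matrix.transpose_apply]
  simp_rw [← Finset.prod_zpow]
  rw [Finset.prod_comm]
  refine Finset.prod_congr rfl fun j _ => ?_
  simp_rw [← zpow_mul]
  exact zpow_finsetSum _ _ _

theorem evalLaurent_torus {d : ℕ} (H : LaurentPoly d) (z : Fin d → ℂˣ) :
    evalLaurent H (torusToAffine z) = H.coeff.sum fun a c => c * (torusMonomial a z : ℂ) := by
  simp only [evalLaurent, coe_torusMonomial]

/-- Restricting to the line in direction `e_j` leaves a single varying factor. -/
theorem mul_fderiv_monomial_torus {d : ℕ} (a : Fin d → ℤ) (z : Fin d → ℂˣ) (j : Fin d) :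
    torusToAffine z j * fderiv ℂ (fun z : Fin d → ℂ => ∏ i, z i ^ a i) (torusToAffine z)
      (Pi.single j 1) = a j * (torusMonomial a z : ℂ) := by
  have hz : ∀ i, torusToAffine z i ≠ 0 := fun i => (z i).ne_zero
  have h1 : DifferentiableAt ℂ (fun z : Fin d → ℂ => ∏ i, z i ^ a i) (torusToAffine z) :=
    (analyticAt_monomial fun i => Or.inl (hz i)).differentiableAt
  have h2 : HasDerivAt (fun s : ℂ => torusToAffine z + s • (Pi.single j (1 : ℂ) : Fin d → ℂ))
      (Pi.single j 1) 0 := by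
    simpa using ((hasDerivAt_id (0 : ℂ)).smul_const
      (Pi.single j (1 : ℂ) : Fin d → ℂ)).const_add (torusToAffine z)
  have h3 := HasFDerivAt.comp_hasDerivAt (x := (0 : ℂ))
    (l := fun z : Fin d → ℂ => ∏ i, z i ^ a i) (by simpa using h1.hasFDerivAt) h2
  have h4 : HasDerivAt (fun s : ℂ => (torusToAffine z j + s) ^ a j *
      ∏ i ∈ Finset.univ.erase j, torusToAffine z i ^ a i)
      ((a j * torusToAffine z j ^ (a j - 1)) *
        ∏ i ∈ Finset.univ.erase j, torusToAffine z i ^ a i) 0 := by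
    have h5 : HasDerivAt (fun s : ℂ => torusToAffine z j + s) 1 0 :=
      (hasDerivAt_id (0 : ℂ)).const_add _
    have h6 := (hasDerivAt_zpow (a j) (torusToAffine z j + 0)
      (Or.inl (by simpa using hz j))).comp (0 : ℂ) h5
    simpa using h6.mul_const _
  have h7 : (fun z : Fin d → ℂ => ∏ i, z i ^ a i) ∘
      (fun s : ℂ => torusToAffine z + s • (Pi.single j (1 : ℂ) : Fin d → ℂ)) =
      fun s : ℂ => (torusToAffine z j + s) ^ a j *
        ∏ i ∈ Finset.univ.erase j, torusToAffine z i ^ a i := by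
    funext s
    simp only [Function.comp]
    rw [← Finset.mul_prod_erase _ _ (Finset.mem_univ j)]
    congr 1
    · simp
    · refine Finset.prod_congr rfl fun i hi => ?_
      simp [Pi.single_eq_of_ne (Finset.ne_of_mem_erase hi)]
  rw [h7] at h3
  rw [h3.unique h4, coe_torusMonomial, ← Finset.mul_prod_erase _ _ (Finset.mem_univ j),
    zpow_sub_one₀ (hz j)]
  have := hz j
  field_simp

theorem logGrad_evalLaurent_torus {d : ℕ} (H : LaurentPoly d) (z : Fin d → ℂˣ) (j : Fin d) :
    logGrad (evalLaurent H) (torusToAffine z) j =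
      H.coeff.sum fun a c => c * (a j * (torusMonomial a z : ℂ)) := by
  have hz : ∀ i, torusToAffine z i ≠ 0 := fun i => (z i).ne_zero
  have h1 : ∀ a : Fin d → ℤ, HasFDerivAt (fun z : Fin d → ℂ => ∏ i, z i ^ a i)
      (fderiv ℂ (fun z : Fin d → ℂ => ∏ i, z i ^ a i) (torusToAffine z)) (torusToAffine z) :=
    fun a => (analyticAt_monomial fun i => Or.inl (hz i)).differentiableAt.hasFDerivAt
  have h2 : HasFDerivAt (evalLaurent H) _ (torusToAffine z) :=
    HasFDerivAt.fun_sum (u := H.coeff.support) fun a _ => (h1 a).const_mul (H.coeff a)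
  simp only [logGrad, grad, Finsupp.sum]
  rw [h2.fderiv, _root_.sum_apply, Finset.mul_sum]
  refine Finset.sum_congr rfl fun a _ => ?_
  rw [← mul_fderiv_monomial_torus a z j]
  simp only [_root_.smul_apply, smul_eq_mul]
  ring

theorem coeff_transformedPoly {d : ℕ} (N : Matrix (Fin d) (Fin d) ℤ) (v : Fin d → ℤ)
    (H : LaurentPoly d) :
    (transformedPoly N v H).coeff = H.coeff.mapDomain fun a => Nᵀ *ᵥ (a - v) := by
  have h1 : (AddMonoidAlgebra.single (-v) 1 * H : LaurentPoly d).coeff =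
      H.coeff.mapDomain fun a => a - v := by
    ext a
    have h2 := Finsupp.mapDomain_apply (sub_left_injective (b := v)) H.coeff (a + v)
    rw [add_sub_cancel_right] at h2
    rw [AddMonoidAlgebra.coeff_single_mul_apply, h2, one_mul, neg_neg, add_comm]
  change (Finsupp.mapDomain _ _) = _
  rw [h1, ← Finsupp.mapDomain_comp]
  rfl

theorem sum_coeff_transformedPoly {d : ℕ} (N : Matrix (Fin d) (Fin d) ℤ) (v : Fin d → ℤ)
    (H : LaurentPoly d) (f : (Fin d → ℤ) → ℂ) :
    ((transformedPoly N v H).coeff.sum fun a c => c * f a) =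
      H.coeff.sum fun a c => c * f (Nᵀ *ᵥ (a - v)) := by
  rw [coeff_transformedPoly]
  exact Finsupp.sum_mapDomain_index (by simp) (fun _ _ _ => by ring)

theorem exists_of_mem_support_transformedPoly {d : ℕ} {N : Matrix (Fin d) (Fin d) ℤ}
    {v : Fin d → ℤ} {H : LaurentPoly d} {b : Fin d → ℤ}
    (hb : b ∈ (transformedPoly N v H).coeff.support) :
    ∃ a ∈ H.coeff.support, b = Nᵀ *ᵥ (a - v) := by
  classical
  rw [coeff_transformedPoly] at hb
  obtain ⟨a, ha, h⟩ := Finset.mem_image.1 (Finsupp.mapDomain_support hb)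
  exact ⟨a, ha, h.symm⟩

theorem evalLaurent_transformedPoly_torus {d : ℕ} (N : Matrix (Fin d) (Fin d) ℤ)
    (v : Fin d → ℤ) (H : LaurentPoly d) (w : Fin d → ℂˣ) :
    evalLaurent (transformedPoly N v H) (torusToAffine w) =
      (torusMonomial (-v) (monomialMap N w) : ℂ) *
        evalLaurent H (torusToAffine (monomialMap N w)) := by
  rw [evalLaurent_torus, evalLaurent_torus, sum_coeff_transformedPoly, Finsupp.mul_sum]
  refine Finset.sum_congr rfl fun a _ => ?_
  beta_reduce
  rw [← torusMonomial_monomialMap, sub_eq_add_neg, torusMonomial_add]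
  push_cast
  ring

/-- Monomial substitutions are linear in logarithmic coordinates, whence the matrix `Nᵀ`. The factor
`z^{-v}` contributes an extra multiple of `H`, which vanishes on the variety. -/
theorem logGrad_transformedPoly_torus {d : ℕ} (N : Matrix (Fin d) (Fin d) ℤ)
    (v : Fin d → ℤ) (H : LaurentPoly d) (w : Fin d → ℂˣ)
    (hw : monomialMap N w ∈ torusVariety H) :
    logGrad (evalLaurent (transformedPoly N v H)) (torusToAffine w) =
      (torusMonomial (-v) (monomialMap N w) : ℂ) •
        ((N.map (Int.cast : ℤ → ℂ))ᵀ *ᵥ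
          logGrad (evalLaurent H) (torusToAffine (monomialMap N w))) := by
  have h0 : (H.coeff.sum fun a c => c * (torusMonomial a (monomialMap N w) : ℂ)) = 0 := by
    rw [← evalLaurent_torus]; exact hw
  funext j
  rw [logGrad_evalLaurent_torus,
    sum_coeff_transformedPoly N v H fun a => (a j : ℂ) * (torusMonomial a w : ℂ)]
  simp only [Pi.smul_apply, Matrix.mulVec, dotProduct, Matrix.transpose_apply, Matrix.map_apply,
    logGrad_evalLaurent_torus, smul_eq_mul]
  -- Shifting each exponent by `v` changes the sum by `v i * H(z) = 0`.
  have h1 : ∀ i, H.coeff.sum (fun a c => c * ((a i : ℂ) *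
      (torusMonomial a (monomialMap N w) : ℂ))) =
      H.coeff.sum fun a c => c * ((((a - v) i : ℤ) : ℂ) *
        (torusMonomial a (monomialMap N w) : ℂ)) := by
    intro i
    have : (v i : ℂ) * (H.coeff.sum fun a c => c * (torusMonomial a (monomialMap N w) : ℂ)) = 0 := by
      rw [h0, mul_zero]
    rw [Finsupp.mul_sum] at this
    rw [← sub_eq_zero, ← Finsupp.sum_sub, ← this]
    refine Finset.sum_congr rfl fun a _ => ?_
    simp only [Pi.sub_apply]
    push_cast
    ring
  simp_rw [h1]
  simp only [Finsupp.sum, Finset.mul_sum]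
  rw [Finset.sum_comm]
  refine Finset.sum_congr rfl fun a _ => ?_
  rw [← torusMonomial_monomialMap, sub_eq_add_neg, torusMonomial_add]
  push_cast
  rw [Finset.sum_mul, Finset.mul_sum]
  refine Finset.sum_congr rfl fun i _ => ?_
  ring

/-! ### Newton polytopes and their faces -/

theorem latticeToReal_injective {d : ℕ} : Function.Injective (latticeToReal (d := d)) := by
  intro a b h
  funext i
  simpa [latticeToReal] using congrFun h i

theorem latticeToReal_add {d : ℕ} (a b : Fin d → ℤ) :
    latticeToReal (a + b) = latticeToReal a + latticeToReal b := by
  funext i; simp [latticeToReal]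

theorem latticeToReal_sub {d : ℕ} (a b : Fin d → ℤ) :
    latticeToReal (a - b) = latticeToReal a - latticeToReal b := by
  funext i; simp [latticeToReal]

theorem latticeToReal_nsmul {d : ℕ} (n : ℕ) (a : Fin d → ℤ) :
    latticeToReal (n • a) = (n : ℝ) • latticeToReal a := by
  funext i; simp [latticeToReal]

theorem latticeToReal_sum {d : ℕ} {ι : Type*} (s : Finset ι) (f : ι → Fin d → ℤ) :
    latticeToReal (∑ i ∈ s, f i) = ∑ i ∈ s, latticeToReal (f i) := by
  funext j; simp [latticeToReal, Finset.sum_apply]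

theorem exists_weights_of_mem_newtonPolytope {d : ℕ} {H : LaurentPoly d} {x : Fin d → ℝ}
    (hx : x ∈ newtonPolytope H) :
    ∃ w : (Fin d → ℤ) → ℝ, (∀ a ∈ H.coeff.support, 0 ≤ w a) ∧ ∑ a ∈ H.coeff.support, w a = 1 ∧
      ∑ a ∈ H.coeff.support, w a • latticeToReal a = x := by
  classical
  unfold newtonPolytope at hx
  rw [← Finset.coe_image, Finset.mem_convexHull'] at hx
  obtain ⟨w, h0, h1, h2⟩ := hx
  have hinj : Set.InjOn (latticeToReal (d := d)) (H.coeff.support : Set (Fin d → ℤ)) :=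
    latticeToReal_injective.injOn
  rw [Finset.sum_image hinj] at h1 h2
  exact ⟨fun a => w (latticeToReal a), fun a ha => h0 _ (Finset.mem_image_of_mem _ ha), h1, h2⟩

theorem mem_newtonPolytope_of_mem_support {d : ℕ} {H : LaurentPoly d} {a : Fin d → ℤ}
    (ha : a ∈ H.coeff.support) : latticeToReal a ∈ newtonPolytope H :=
  subset_convexHull ℝ _ ⟨a, ha, rfl⟩

theorem convex_newtonPolytope {d : ℕ} (H : LaurentPoly d) : Convex ℝ (newtonPolytope H) :=
  convex_convexHull ℝ _

/-- The deficits of the exposing functional at the exponents are nonnegative with weighted sum zero,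
so every exponent of nonzero weight attains the maximum. -/
theorem exists_weights_of_mem_face {d : ℕ} {H : LaurentPoly d} {G : Set (Fin d → ℝ)}
    (hG : IsFace (newtonPolytope H) G) {x : Fin d → ℝ} (hx : x ∈ G) :
    ∃ w : (Fin d → ℤ) → ℝ, (∀ a ∈ H.coeff.support, w a ≠ 0 → latticeToReal a ∈ G) ∧
      ∑ a ∈ H.coeff.support, w a = 1 ∧ ∑ a ∈ H.coeff.support, w a • latticeToReal a = x := by
  obtain ⟨l, hl⟩ := hG.2 hG.1
  have hx' := hx
  rw [hl] at hx'
  obtain ⟨hxP, hxm⟩ := hx'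
  obtain ⟨w, h0, h1, h2⟩ := exists_weights_of_mem_newtonPolytope hxP
  refine ⟨w, fun a ha hwa => ?_, h1, h2⟩
  have h3 : ∑ a ∈ H.coeff.support, w a * (l x - l (latticeToReal a)) = 0 := by
    simp only [mul_sub, Finset.sum_sub_distrib, ← Finset.sum_mul, h1]
    conv_lhs => rw [← h2]
    simp
  have h4 := (Finset.sum_eq_zero_iff_of_nonneg fun a ha => mul_nonneg (h0 a ha)
    (sub_nonneg.2 (hxm _ (mem_newtonPolytope_of_mem_support ha)))).1 h3 a ha
  have h5 : l x = l (latticeToReal a) := by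
    rcases mul_eq_zero.1 h4 with h | h
    · exact absurd h hwa
    · linarith
  rw [hl]
  exact ⟨mem_newtonPolytope_of_mem_support ha, fun y hy => h5 ▸ hxm y hy⟩

/-- For a normal polytope `κ𝒫`, the lattice points of a face generate the lattice of its direction
space. -/
theorem mem_closure_of_mem_directionSpace {d : ℕ} {H : LaurentPoly d} {κ : ℕ} (hκ : 1 ≤ κ)
    (hnormal : IsNormalPolytope (enlargedPolytope H κ)) {G : Set (Fin d → ℝ)}
    (hG : IsFace (newtonPolytope H) G) {v : Fin d → ℤ} (hv : latticeToReal v ∈ G)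
    {b : Fin d → ℤ} (hb : latticeToReal b ∈ directionSpace ((κ : ℝ) • G)) :
    b ∈ AddSubgroup.closure {a | ∃ m ∈ latticePoints (enlargedPolytope H κ),
      latticeToReal m ∈ (κ : ℝ) • G ∧ a = m - κ • v} := by
  classical
  have hκ0 : (κ : ℝ) ≠ 0 := by positivity
  have hκp : (0 : ℝ) < κ := by positivity
  set T := H.coeff.support.filter fun a => latticeToReal a ∈ G with hT
  have hTmem : ∀ a ∈ T, a ∈ H.coeff.support ∧ latticeToReal a ∈ G := fun a ha =>
    Finset.mem_filter.1 ha
  have hface : ∀ x ∈ G, ∃ w : (Fin d → ℤ) → ℝ, ∑ a ∈ T, w a = 1 ∧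
      ∑ a ∈ T, w a • latticeToReal a = x := by
    intro x hx
    obtain ⟨w, h1, h2, h3⟩ := exists_weights_of_mem_face hG hx
    refine ⟨w, ?_, ?_⟩
    · rw [← h2, hT]
      exact Finset.sum_filter_of_ne h1
    · rw [← h3, hT]
      exact Finset.sum_filter_of_ne fun a ha h => h1 a ha fun h0 => h (by simp [h0])
  have hspan : ∀ x ∈ directionSpace ((κ : ℝ) • G), ∃ c : (Fin d → ℤ) → ℝ, ∑ a ∈ T, c a = 0 ∧
      ∑ a ∈ T, c a • ((κ : ℝ) • latticeToReal a) = x := by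
    intro x hx
    unfold directionSpace vectorSpan at hx
    induction hx using Submodule.span_induction with
    | mem x hx =>
      obtain ⟨_, ⟨y, hy, rfl⟩, _, ⟨y', hy', rfl⟩, rfl⟩ := hx
      obtain ⟨w, hw1, hw2⟩ := hface y hy
      obtain ⟨w', hw1', hw2'⟩ := hface y' hy'
      refine ⟨w - w', by simp [hw1, hw1'], ?_⟩
      simp only [Pi.sub_apply, sub_smul, Finset.sum_sub_distrib, smul_comm _ (κ : ℝ),
        ← Finset.smul_sum, hw2, hw2', vsub_eq_sub]
      exact smul_sub _ _ _
    | zero => exact ⟨0, by simp, by simp⟩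
    | add x y _ _ hx hy =>
      obtain ⟨c, h1, h2⟩ := hx
      obtain ⟨c', h1', h2'⟩ := hy
      exact ⟨c + c', by simp [Finset.sum_add_distrib, h1, h1'],
        by simp only [Pi.add_apply, add_smul, Finset.sum_add_distrib, h2, h2']⟩
    | smul r x _ hx =>
      obtain ⟨c, h1, h2⟩ := hx
      refine ⟨r • c, by simp [← Finset.mul_sum, h1], ?_⟩
      simp only [Pi.smul_apply, smul_eq_mul, mul_smul, ← Finset.smul_sum]
      rw [← h2]
  obtain ⟨c, hc0, hcb⟩ := hspan _ hb
  have hTne : T.Nonempty := by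
    obtain ⟨w, h1, -⟩ := hface _ hv
    by_contra h
    rw [Finset.not_nonempty_iff_eq_empty] at h
    simp [h] at h1
  obtain ⟨M, hM⟩ : ∃ M : ℕ, ∀ a ∈ T, |c a| ≤ M := by
    obtain ⟨M, hM⟩ := exists_nat_ge (∑ a ∈ T, |c a|)
    exact ⟨M, fun a ha => (Finset.single_le_sum (f := fun a => |c a|)
      (fun _ _ => abs_nonneg _) ha).trans hM⟩
  -- Adding `M + 1` to every `c a` makes the coefficients positive, and as the `c a` sum to `0` the
  -- new total is the integer `K`. Thus `b + q` lands in `K • Q`.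
  set K := (M + 1) * T.card with hK
  have hK1 : 1 ≤ K := Nat.mul_pos (Nat.succ_pos _) hTne.card_pos
  have hKp : (0 : ℝ) < K := by exact_mod_cast hK1
  set q : Fin d → ℤ := (M + 1) • ∑ a ∈ T, κ • a with hq
  have hbq : latticeToReal (b + q) = ∑ a ∈ T, (c a + (M + 1)) • ((κ : ℝ) • latticeToReal a) := by
    rw [latticeToReal_add, ← hcb, hq, latticeToReal_nsmul, latticeToReal_sum]
    simp only [latticeToReal_nsmul, add_smul _ ((M : ℝ) + 1), Finset.sum_add_distrib,
      Finset.smul_sum]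
    push_cast
    rfl
  have hsum : ∑ a ∈ T, (c a + ((M : ℝ) + 1)) = K := by
    rw [Finset.sum_add_distrib, hc0, hK]
    simp
    ring
  have hmem : b + q ∈ latticePoints ((K : ℝ) • enlargedPolytope H κ) := by
    have h1 : ∑ a ∈ T, ((c a + ((M : ℝ) + 1)) / K) • latticeToReal a ∈ newtonPolytope H := by
      refine (convex_newtonPolytope H).sum_mem (fun a ha => ?_) ?_ fun a ha =>
        mem_newtonPolytope_of_mem_support (hTmem a ha).1
      · have := (abs_le.1 (hM a ha)).1
        exact div_nonneg (by linarith) hKp.le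
      · rw [← Finset.sum_div, hsum, div_self hKp.ne']
    refine ⟨_, ⟨_, h1, rfl⟩, ?_⟩
    rw [hbq]
    simp only [Finset.smul_sum]
    refine Finset.sum_congr rfl fun a _ => ?_
    simp only [smul_smul]
    congr 1
    field_simp
  -- Normality splits `b + q` into `K` lattice points of `Q`. The functional `l` is at most `κ * l
  -- v` on each, and their sum attains the bound, so all of them lie on the face.
  obtain ⟨f, hf⟩ := hnormal K hK1 _ hmem
  obtain ⟨l, hl⟩ := hG.2 hG.1
  have hle : ∀ x ∈ newtonPolytope H, l x ≤ l (latticeToReal v) := fun x hx => by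
    rw [hl] at hv
    exact hv.2 x hx
  have heq : ∀ x ∈ G, l x = l (latticeToReal v) := fun x hx => by
    rw [hl] at hx hv
    exact le_antisymm (hv.2 x hx.1) (hx.2 _ hv.1)
  have hfl : ∀ i, l (latticeToReal (f i : Fin d → ℤ)) ≤ κ * l (latticeToReal v) := by
    intro i
    obtain ⟨y, hy, hyf⟩ := (f i).2
    rw [← hyf]
    simp only [map_smul, smul_eq_mul]
    exact mul_le_mul_of_nonneg_left (hle y hy) hκp.le
  have hfsum : ∑ i, (κ * l (latticeToReal v) - l (latticeToReal (f i : Fin d → ℤ))) = 0 := by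
    rw [Finset.sum_sub_distrib, ← map_sum, ← latticeToReal_sum, hf, hbq, map_sum]
    have : ∀ a ∈ T, l ((c a + (M + 1)) • ((κ : ℝ) • latticeToReal a)) =
        (c a + (M + 1)) * (κ * l (latticeToReal v)) := by
      intro a ha
      rw [map_smul, map_smul, heq _ (hTmem a ha).2, smul_eq_mul, smul_eq_mul]
    rw [Finset.sum_congr rfl this, ← Finset.sum_mul (s := T), hsum]
    simp
  have hfG : ∀ i, latticeToReal (f i : Fin d → ℤ) ∈ (κ : ℝ) • G := by
    intro i
    have h1 := (Finset.sum_eq_zero_iff_of_nonneg fun i _ => sub_nonneg.2 (hfl i)).1 hfsum i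
      (Finset.mem_univ i)
    obtain ⟨y, hy, hyf⟩ := (f i).2
    refine ⟨y, ?_, hyf⟩
    rw [← hyf] at h1
    simp only [map_smul, smul_eq_mul, ← mul_sub, mul_eq_zero, hκ0, false_or] at h1
    rw [hl]
    exact ⟨hy, fun x hx => (hle x hx).trans (by linarith)⟩
  have hbe : b = ∑ i, ((f i : Fin d → ℤ) - κ • v) - (M + 1) • ∑ a ∈ T, (κ • a - κ • v) := by
    rw [Finset.sum_sub_distrib, hf, Finset.sum_sub_distrib, smul_sub, ← hq]
    simp only [Finset.sum_const, Finset.card_univ, Fintype.card_fin, hK, mul_smul]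
    abel
  rw [hbe]
  refine sub_mem (sum_mem fun i _ => AddSubgroup.subset_closure ⟨f i, (f i).2, hfG i, rfl⟩)
    (nsmul_mem (sum_mem fun a ha => ?_) _)
  refine AddSubgroup.subset_closure ⟨κ • a, ?_, ?_, rfl⟩
  · exact ⟨_, mem_newtonPolytope_of_mem_support (hTmem a ha).1, (latticeToReal_nsmul _ _).symm⟩
  · exact ⟨_, (hTmem a ha).2, (latticeToReal_nsmul _ _).symm⟩

/-! ### Simplicial cones -/

/-- The independent generators of the cone form a basis of `E ⧸ L`, and each coordinate hyperplane
is spanned by the generators it contains. So a vector dual to the `j`-th coordinate uses only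
generators killed by all others, one of them with nonzero `j`-th coordinate. By nonnegativity, some
point of `A` contributing to that generator has the same property. -/
theorem exists_ray_of_isSimplicial {E : Type*} [AddCommGroup E] [Module ℝ E] {L : Submodule ℝ E}
    {A : Set E} {k : ℕ} {φ : E →ₗ[ℝ] (Fin k → ℝ)} (hker : LinearMap.ker φ = L)
    (hsurj : Function.Surjective φ) (hnonneg : ∀ x ∈ A, ∀ j, 0 ≤ φ x j)
    (hfacet : ∀ j x, φ x j = 0 → x ∈ Submodule.span ℝ {x ∈ A | φ x j = 0})
    (hspan : Submodule.span ℝ A = ⊤)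
    (hC : (PointedCone.map L.mkQ (PointedCone.hull ℝ (L.mkQ ⁻¹' (L.mkQ '' A)))).IsSimplicial)
    (j : Fin k) : ∃ x ∈ A, 0 < φ x j ∧ ∀ i, i ≠ j → φ x i = 0 := by
  classical
  obtain ⟨U, -, hli, hU⟩ := hC
  set C := PointedCone.map L.mkQ (PointedCone.hull ℝ (L.mkQ ⁻¹' (L.mkQ '' A))) with hCdef
  let ψ : (E ⧸ L) →ₗ[ℝ] (Fin k → ℝ) := L.liftQ φ hker.ge
  have hψ : ∀ x, ψ (L.mkQ x) = φ x := fun x => rfl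
  have hAC : ∀ x ∈ A, L.mkQ x ∈ C := fun x hx =>
    ⟨x, Submodule.subset_span ⟨x, hx, rfl⟩, rfl⟩
  -- an element of the cone with a vanishing coordinate
  have hCA : ∀ u ∈ C, (∀ i, 0 ≤ ψ u i) ∧
      ((∀ x ∈ A, (∀ i, i ≠ j → φ x i = 0) → φ x j = 0) →
        (∀ i, i ≠ j → ψ u i = 0) → ψ u j = 0) := by
    rintro _ ⟨y, hy, rfl⟩
    change (∀ i, 0 ≤ φ y i) ∧ (_ → (∀ i, i ≠ j → φ y i = 0) → φ y j = 0)
    induction hy using Submodule.span_induction with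
    | mem y hy =>
      obtain ⟨x, hx, hxy⟩ := hy
      have : φ y = φ x := by rw [← hψ, ← hxy, hψ]
      rw [this]
      exact ⟨hnonneg x hx, fun h => h x hx⟩
    | zero => simp
    | add x y _ _ hx hy =>
      refine ⟨fun i => ?_, fun h h0 => ?_⟩
      · simpa using add_nonneg (hx.1 i) (hy.1 i)
      · have h1 : ∀ i, i ≠ j → φ x i = 0 ∧ φ y i = 0 := fun i hi => by
          have := h0 i hi
          simp only [map_add, Pi.add_apply] at this
          have := hx.1 i
          have := hy.1 i
          constructor <;> linarith
        simp [hx.2 h fun i hi => (h1 i hi).1, hy.2 h fun i hi => (h1 i hi).2]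
    | smul c x _ hx =>
      have hc : ∀ i, φ (c • x) i = (c : ℝ) * φ x i := fun i => by
        rw [show c • x = (c : ℝ) • x from rfl, map_smul]; rfl
      refine ⟨fun i => ?_, fun h h0 => ?_⟩
      · rw [hc]; exact mul_nonneg c.2 (hx.1 i)
      · rw [hc]
        by_cases hc0 : (c : ℝ) = 0
        · rw [hc0, zero_mul]
        · rw [hx.2 h fun i hi => ?_, mul_zero]
          have := h0 i hi
          rw [hc] at this
          exact (mul_eq_zero.1 this).resolve_left hc0
  have hUC : ∀ u ∈ U, u ∈ C := fun u hu => hU ▸ Submodule.subset_span hu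
  -- the generators on which a coordinate vanishes span its kernel
  have hUspan : ∀ i, ∀ y ∈ C, ψ y i = 0 → y ∈ Submodule.span ℝ {u ∈ U | ψ u i = 0} := by
    intro i y hy
    rw [← hU] at hy
    suffices 0 ≤ ψ y i ∧ (ψ y i = 0 → y ∈ Submodule.span ℝ {u ∈ U | ψ u i = 0}) from this.2
    induction hy using Submodule.span_induction with
    | mem y hy => exact ⟨(hCA y (hUC y hy)).1 i, fun h => Submodule.subset_span ⟨hy, h⟩⟩
    | zero => simp
    | add x y _ _ hx hy =>
      simp only [map_add, Pi.add_apply]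
      refine ⟨add_nonneg hx.1 hy.1, fun h => ?_⟩
      exact add_mem (hx.2 (by linarith [hx.1, hy.1])) (hy.2 (by linarith [hx.1, hy.1]))
    | smul c x _ hx =>
      have hc : ψ (c • x) i = (c : ℝ) * ψ x i := by
        rw [show c • x = (c : ℝ) • x from rfl, map_smul]; rfl
      rw [hc]
      refine ⟨mul_nonneg c.2 hx.1, fun h => ?_⟩
      rw [show c • x = (c : ℝ) • x from rfl]
      by_cases hc0 : (c : ℝ) = 0
      · rw [hc0, zero_smul]; exact zero_mem _
      · exact Submodule.smul_mem _ _ (hx.2 ((mul_eq_zero.1 h).resolve_left hc0))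
  have hkerspan : ∀ i x, φ x i = 0 → L.mkQ x ∈ Submodule.span ℝ {u ∈ U | ψ u i = 0} := by
    intro i x hx
    have h1 := Submodule.mem_map_of_mem (f := L.mkQ) (hfacet i x hx)
    rw [Submodule.map_span] at h1
    refine Submodule.span_le.2 ?_ h1
    rintro _ ⟨x, hx, rfl⟩
    exact hUspan i _ (hAC x hx.1) hx.2
  have hUtop : ⊤ ≤ Submodule.span ℝ (Set.range (Subtype.val : U → E ⧸ L)) := by
    rw [Subtype.range_coe]
    have h1 : Submodule.map L.mkQ (Submodule.span ℝ A) = ⊤ := by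
      rw [hspan, Submodule.map_top, Submodule.range_mkQ]
    rw [← h1, Submodule.map_span, Submodule.span_le]
    rintro _ ⟨x, hx, rfl⟩
    have h2 := hAC x hx
    rw [← hU] at h2
    exact Submodule.span_le_restrictScalars { c : ℝ // 0 ≤ c } ℝ U h2
  let b : Module.Basis U ℝ (E ⧸ L) := Module.Basis.mk hli hUtop
  have hb : ∀ u : U, b u = u := fun u => Module.Basis.mk_apply _ _ _
  obtain ⟨x, hx⟩ := hsurj (Pi.single j 1)
  -- Uniqueness of the expansion in the basis: membership in the span of a subset of basis vectors
  -- confines the support to that subset, for every `i ≠ j` simultaneously.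
  have hsupp : ∀ i, i ≠ j → ∀ u ∈ (b.repr (L.mkQ x)).support, ψ (u : E ⧸ L) i = 0 := by
    intro i hi u hu
    have h1 := hkerspan i x (by rw [hx, Pi.single_eq_of_ne hi])
    have h2 : {u ∈ U | ψ u i = 0} = b '' {u : U | ψ (u : E ⧸ L) i = 0} := by
      ext y
      constructor
      · rintro ⟨hy, hy'⟩
        exact ⟨⟨y, hy⟩, hy', hb _⟩
      · rintro ⟨u, hu, rfl⟩
        rw [hb]
        exact ⟨u.2, hu⟩
    rw [h2, b.mem_span_image] at h1
    exact h1 hu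
  have hsum : ∑ u ∈ (b.repr (L.mkQ x)).support, b.repr (L.mkQ x) u * ψ (u : E ⧸ L) j = 1 := by
    have h1 : ψ (L.mkQ x) j = 1 := by rw [hψ, hx, Pi.single_eq_same]
    rw [← b.linearCombination_repr (L.mkQ x), Finsupp.linearCombination_apply, Finsupp.sum,
      map_sum, Finset.sum_apply] at h1
    simpa [hb] using h1
  obtain ⟨u, hu, hu0⟩ := Finset.exists_ne_zero_of_sum_ne_zero (hsum ▸ one_ne_zero)
  by_contra hcon
  push Not at hcon
  refine hu0 ?_
  rw [(hCA u (hUC u u.2)).2 (fun x hx h => ?_) (fun i hi => hsupp i hi u hu), mul_zero]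
  by_contra hne
  obtain ⟨i, hi, hi'⟩ := hcon x hx (lt_of_le_of_ne (hnonneg x hx j) (Ne.symm hne))
  exact hi' (h i hi)

/-! ### Characters of lattices -/

/-- Roots exist in an algebraically closed field, so `ℂˣ` is divisible and hence injective over `ℤ`:
characters of lattices extend. -/
theorem baer_additive_units_complex : Module.Baer ℤ (Additive ℂˣ) := by
  have h1 : DivisibleBy (Additive ℂˣ) ℕ := by
    refine divisibleByOfSMulRightSurj _ _ fun {n} hn x => ?_
    obtain ⟨y, hy⟩ := IsAlgClosed.exists_pow_nat_eq ((Additive.toMul x : ℂˣ) : ℂ)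
      (Nat.pos_of_ne_zero hn)
    have hy0 : y ≠ 0 := by
      rintro rfl
      rw [zero_pow hn] at hy
      exact (Additive.toMul x).ne_zero hy.symm
    refine ⟨Additive.ofMul (Units.mk0 y hy0), ?_⟩
    apply Additive.toMul.injective
    ext
    simpa using hy
  have h2 : DivisibleBy (Additive ℂˣ) ℤ := AddGroup.divisibleByIntOfDivisibleByNat _
  exact Module.Baer.of_divisible _

theorem Module.Baer.exists_extension {R M N Q : Type*} [CommRing R] [AddCommGroup M] [Module R M]
    [AddCommGroup N] [Module R N] [AddCommGroup Q] [Module R Q] (hQ : Module.Baer R Q)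
    (i : M →ₗ[R] N) (g : M →ₗ[R] Q) (h : LinearMap.ker i ≤ LinearMap.ker g) :
    ∃ f : N →ₗ[R] Q, ∀ x, f (i x) = g x := by
  obtain ⟨f, hf⟩ := hQ.extension_property ((LinearMap.ker i).liftQ i le_rfl)
    (LinearMap.ker_eq_bot.1 (Submodule.ker_liftQ_eq_bot _ _ _ le_rfl))
    ((LinearMap.ker i).liftQ g h)
  exact ⟨f, fun x => LinearMap.congr_fun hf (Submodule.Quotient.mk x)⟩

/-- The character of `ℤⁿ` given by a point of a torus. -/
def latticeCharacter {n : ℕ} (ζ : Fin n → ℂˣ) : (Fin n → ℤ) →ₗ[ℤ] Additive ℂˣ :=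
  AddMonoidHom.toIntLinearMap
    { toFun := fun a => Additive.ofMul (torusMonomial a ζ)
      map_zero' := by rw [torusMonomial_zero]; rfl
      map_add' := fun a b => by rw [torusMonomial_add]; rfl }

theorem latticeCharacter_apply {n : ℕ} (ζ : Fin n → ℂˣ) (a : Fin n → ℤ) :
    latticeCharacter ζ a = Additive.ofMul (torusMonomial a ζ) := rfl

theorem exists_latticeCharacter_eq {n : ℕ} (f : (Fin n → ℤ) →ₗ[ℤ] Additive ℂˣ) :
    ∃ ζ : Fin n → ℂˣ, f = latticeCharacter ζ := by
  refine ⟨fun i => (f (Pi.single i 1)).toMul, ?_⟩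
  refine LinearMap.pi_ext' fun i => LinearMap.ext_ring ?_
  change f (Pi.single i 1) = Additive.ofMul (torusMonomial (Pi.single i 1) _)
  unfold torusMonomial
  rw [Finset.prod_eq_single i]
  · simp
  · intro j _ hj
    rw [Pi.single_eq_of_ne hj, zpow_zero]
  · simp

theorem mulVec_transpose_injective {d : ℕ} {N : Matrix (Fin d) (Fin d) ℤ} (hN : N.det ≠ 0) :
    Function.Injective fun a : Fin d → ℤ => Nᵀ *ᵥ a := by
  refine (injective_iff_map_eq_zero Nᵀ.mulVecLin).2 fun a ha => ?_
  exact Matrix.eq_zero_of_mulVec_eq_zero (by rwa [Matrix.det_transpose]) ha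

/-- Points of the torus are characters of `ℤᵈ`, and `τ_N` is precomposition with the injective map
`Nᵀ`; a preimage is an extension of a character. -/
theorem exists_monomialMap_eq {d : ℕ} {N : Matrix (Fin d) (Fin d) ℤ} (hN : N.det ≠ 0)
    (z : Fin d → ℂˣ) : ∃ w, monomialMap N w = z := by
  obtain ⟨f, hf⟩ := baer_additive_units_complex.exists_extension Nᵀ.mulVecLin (latticeCharacter z)
    (by
      rw [LinearMap.ker_eq_bot.2 (mulVec_transpose_injective hN)]
      exact bot_le)
  obtain ⟨w, rfl⟩ := exists_latticeCharacter_eq f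
  refine ⟨w, funext fun i => ?_⟩
  have h1 := hf (Pi.single i 1)
  simp only [latticeCharacter_apply, Matrix.mulVecLin_apply] at h1
  have h2 := Additive.ofMul.injective h1
  rw [Matrix.mulVec_single_one] at h2
  rw [monomialMap]
  change torusMonomial (Nᵀ.col i) w = _
  rw [h2]
  unfold torusMonomial
  rw [Finset.prod_eq_single i]
  · simp
  · intro j _ hj
    rw [Pi.single_eq_of_ne hj, zpow_zero]
  · simp

/-- An element of `ker τ_N` is a character of `ℤᵈ ⧸ range Nᵀ`. Prescribing its first `e` coordinates
prescribes it on the image of `ℤᵉ`; the hypothesis on `ζ` is exactly that this is well defined, and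
divisibility extends it. -/
theorem exists_monomialMap_eq_one {e k : ℕ} {N : Matrix (Fin (e + k)) (Fin (e + k)) ℤ}
    (ζ : Fin (e + k) → ℂˣ)
    (hζ : ∀ a, (∀ j, (Nᵀ *ᵥ a) (Fin.natAdd e j) = 0) → torusMonomial (Nᵀ *ᵥ a) ζ = 1) :
    ∃ ω, monomialMap N ω = 1 ∧ ∀ i, ω (Fin.castAdd k i) = ζ (Fin.castAdd k i) := by
  let ι : (Fin e → ℤ) →ₗ[ℤ] (Fin (e + k) → ℤ) := LinearMap.pi (Fin.addCases
    (fun i => LinearMap.proj i) fun _ => 0)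
  have hι1 : ∀ x i, ι x (Fin.castAdd k i) = x i := fun x i => by simp [ι]
  have hι2 : ∀ x j, ι x (Fin.natAdd e j) = 0 := fun x j => by simp [ι]
  let L := LinearMap.range Nᵀ.mulVecLin
  obtain ⟨f, hf⟩ := baer_additive_units_complex.exists_extension (L.mkQ ∘ₗ ι)
    (latticeCharacter ζ ∘ₗ ι) (by
      intro x hx
      obtain ⟨a, ha⟩ : ι x ∈ L := by simpa using hx
      rw [Matrix.mulVecLin_apply] at ha
      have h1 := hζ a fun j => by rw [ha, hι2]
      rw [ha] at h1
      change Additive.ofMul (torusMonomial (ι x) ζ) = 0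
      rw [h1]
      rfl)
  obtain ⟨ω, hω⟩ := exists_latticeCharacter_eq (f ∘ₗ L.mkQ)
  have happ : ∀ a, Additive.ofMul (torusMonomial a ω) = f (L.mkQ a) := fun a => by
    rw [← latticeCharacter_apply, ← hω]
    rfl
  refine ⟨ω, funext fun i => ?_, fun i => ?_⟩
  · have h1 := happ (N i)
    have h2 : L.mkQ (N i) = 0 := by
      rw [Submodule.mkQ_apply, Submodule.Quotient.mk_eq_zero]
      exact ⟨Pi.single i 1, by rw [Matrix.mulVecLin_apply, Matrix.mulVec_single_one]; rfl⟩
    rw [h2, map_zero] at h1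
    exact Additive.ofMul.injective h1
  · have h1 := (happ (ι (Pi.single i 1))).trans (hf (Pi.single i 1))
    have h2 : torusMonomial (ι (Pi.single i 1)) ω = torusMonomial (ι (Pi.single i 1)) ζ :=
      Additive.ofMul.injective h1
    have h3 : ∀ z : Fin (e + k) → ℂˣ,
        torusMonomial (ι (Pi.single i 1)) z = z (Fin.castAdd k i) := by
      intro z
      unfold torusMonomial
      rw [Finset.prod_eq_single (Fin.castAdd k i)]
      · rw [hι1]; simp
      · intro j _ hj
        induction j using Fin.addCases with
        | left j =>
          rw [hι1, Pi.single_eq_of_ne (fun h => hj (by rw [h])), zpow_zero]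
        | right j => rw [hι2, zpow_zero]
      · simp
    rwa [h3, h3] at h2

/-! ### The facet normals -/

/-- The linear map whose coordinates are the scalar products with the last `k` columns of `N`. -/
def normalMap {e k : ℕ} (N : Matrix (Fin (e + k)) (Fin (e + k)) ℤ) :
    (Fin (e + k) → ℝ) →ₗ[ℝ] (Fin k → ℝ) :=
  (Matrix.of fun j i => (N i (Fin.natAdd e j) : ℝ) : Matrix (Fin k) (Fin (e + k)) ℝ).mulVecLin

theorem normalMap_apply {e k : ℕ} (N : Matrix (Fin (e + k)) (Fin (e + k)) ℤ)
    (x : Fin (e + k) → ℝ) (j : Fin k) :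
    normalMap N x j = latticeToReal (fun i => N i (Fin.natAdd e j)) ⬝ᵥ x := rfl

theorem normalMap_latticeToReal {e k : ℕ} (N : Matrix (Fin (e + k)) (Fin (e + k)) ℤ)
    (a : Fin (e + k) → ℤ) (j : Fin k) :
    normalMap N (latticeToReal a) j = ((Nᵀ *ᵥ a) (Fin.natAdd e j) : ℤ) := by
  rw [normalMap_apply]
  simp [dotProduct, Matrix.mulVec, latticeToReal]

theorem normalMap_surjective {e k : ℕ} {N : Matrix (Fin (e + k)) (Fin (e + k)) ℤ}
    (hN : N.det ≠ 0) : Function.Surjective (normalMap N) := by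
  intro y
  let M : Matrix (Fin (e + k)) (Fin (e + k)) ℝ := (N.map (Int.cast : ℤ → ℝ))ᵀ
  have hM : IsUnit M.det := by
    rw [Matrix.det_transpose]
    have : (N.map (Int.cast : ℤ → ℝ)).det = (N.det : ℝ) := (Int.cast_det N).symm
    rw [this]
    exact isUnit_iff_ne_zero.2 (by exact_mod_cast hN)
  let u : Fin (e + k) → ℝ := Fin.addCases (fun _ => 0) y
  have h1 : M *ᵥ (M⁻¹ *ᵥ u) = u := by
    rw [Matrix.mulVec_mulVec, Matrix.mul_nonsing_inv _ hM, Matrix.one_mulVec]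
  refine ⟨M⁻¹ *ᵥ u, funext fun j => ?_⟩
  have h2 := congrFun h1 (Fin.natAdd e j)
  have h3 : u (Fin.natAdd e j) = y j := by simp [u]
  rw [h3] at h2
  exact h2

theorem finrank_ker_normalMap {e k : ℕ} {N : Matrix (Fin (e + k)) (Fin (e + k)) ℤ}
    (hN : N.det ≠ 0) : Module.finrank ℝ (LinearMap.ker (normalMap N)) = e := by
  have h1 := LinearMap.finrank_range_add_finrank_ker (normalMap N)
  rw [LinearMap.range_eq_top.2 (normalMap_surjective hN), finrank_top] at h1
  simp at h1
  omega

section Facets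

variable {e k : ℕ} {H : LaurentPoly (e + k)} {κ : ℕ} {smallF : Set (Fin (e + k) → ℝ)}
  {v : Fin (e + k) → ℤ} {facets : Fin k → Set (Fin (e + k) → ℝ)}
  {N : Matrix (Fin (e + k)) (Fin (e + k)) ℤ}

theorem normalMap_sub_nonneg (hv : ∀ j, latticeToReal v ∈ facets j)
    (hnormals : ∀ j : Fin k, IsInwardNormal (newtonPolytope H) (facets j)
      (fun i => N i (Fin.natAdd e j)))
    {x : Fin (e + k) → ℝ} (hx : x ∈ newtonPolytope H) (j : Fin k) :
    0 ≤ normalMap N (x - latticeToReal v) j :=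
  (hnormals j).2.2 x hx _ (hv j)

theorem normalMap_sub_eq_zero
    (hnormals : ∀ j : Fin k, IsInwardNormal (newtonPolytope H) (facets j)
      (fun i => N i (Fin.natAdd e j)))
    (hsub : ∀ j, smallF ⊆ facets j)
    {x y : Fin (e + k) → ℝ} (hx : x ∈ smallF) (hy : y ∈ smallF) :
    normalMap N (x - y) = 0 :=
  funext fun j => (hnormals j).2.1 _ (vsub_mem_vectorSpan ℝ (hsub j hx) (hsub j hy))

/-- The normals annihilate the face, and both spaces have dimension `e`. -/
theorem directionSpace_eq_ker
    (hnormals : ∀ j : Fin k, IsInwardNormal (newtonPolytope H) (facets j)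
      (fun i => N i (Fin.natAdd e j)))
    (hsub : ∀ j, smallF ⊆ facets j) (hN : N.det ≠ 0)
    (hdim : Module.finrank ℝ (directionSpace ((κ : ℝ) • smallF)) = e) :
    directionSpace ((κ : ℝ) • smallF) = LinearMap.ker (normalMap N) := by
  refine Submodule.eq_of_le_of_finrank_eq ?_ (by rw [hdim, finrank_ker_normalMap hN])
  refine Submodule.span_le.2 ?_
  rintro _ ⟨_, ⟨x, hx, rfl⟩, _, ⟨y, hy, rfl⟩, rfl⟩
  have h1 : ((κ : ℝ) • x -ᵥ (κ : ℝ) • y : Fin (e + k) → ℝ) = (κ : ℝ) • (x - y) :=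
    (smul_sub _ _ _).symm
  change (κ : ℝ) • x -ᵥ (κ : ℝ) • y ∈ LinearMap.ker (normalMap N)
  rw [h1, LinearMap.mem_ker, map_smul, normalMap_sub_eq_zero hnormals hsub hx hy, smul_zero]

theorem mulVec_transpose_nonneg (hv : ∀ j, latticeToReal v ∈ facets j)
    (hnormals : ∀ j : Fin k, IsInwardNormal (newtonPolytope H) (facets j)
      (fun i => N i (Fin.natAdd e j)))
    {m : Fin (e + k) → ℤ} (hm : m ∈ latticePoints (enlargedPolytope H κ)) (j : Fin k) :
    0 ≤ (Nᵀ *ᵥ (m - κ • v)) (Fin.natAdd e j) := by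
  obtain ⟨x, hx, hxm⟩ := hm
  have h1 := normalMap_latticeToReal N (m - κ • v) j
  rw [latticeToReal_sub, latticeToReal_nsmul, ← hxm] at h1
  change normalMap N ((κ : ℝ) • x - _) j = _ at h1
  rw [← smul_sub, map_smul, Pi.smul_apply, smul_eq_mul] at h1
  have h2 := mul_nonneg (Nat.cast_nonneg (α := ℝ) κ) (normalMap_sub_nonneg hv hnormals hx j)
  rw [h1] at h2
  exact_mod_cast h2

theorem mulVec_transpose_eq_zero (hv : latticeToReal v ∈ smallF)
    (hnormals : ∀ j : Fin k, IsInwardNormal (newtonPolytope H) (facets j)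
      (fun i => N i (Fin.natAdd e j)))
    (hsub : ∀ j, smallF ⊆ facets j)
    {m : Fin (e + k) → ℤ} (hm : latticeToReal m ∈ (κ : ℝ) • smallF) (j : Fin k) :
    (Nᵀ *ᵥ (m - κ • v)) (Fin.natAdd e j) = 0 := by
  obtain ⟨x, hx, hxm⟩ := hm
  have h1 := normalMap_latticeToReal N (m - κ • v) j
  rw [latticeToReal_sub, latticeToReal_nsmul, ← hxm] at h1
  change normalMap N ((κ : ℝ) • x - _) j = _ at h1
  rw [← smul_sub, map_smul, normalMap_sub_eq_zero hnormals hsub hx hv, smul_zero,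
    Pi.zero_apply] at h1
  exact_mod_cast h1.symm

/-- The ray point given by `exists_ray_of_isSimplicial` need not be a lattice point. It is a convex
combination of exponents scaled by `κ`; by nonnegativity every exponent of positive weight also lies
on the ray or at its apex modulo `L_F`, and one is off the apex. -/
theorem exists_lattice_ray (hκ : 1 ≤ κ) (hfull : affineSpan ℝ (newtonPolytope H) = ⊤)
    (hv : latticeToReal v ∈ smallF) (hvP : latticeToReal v ∈ newtonPolytope H)
    (hfacets : ∀ j, IsFacet (newtonPolytope H) (facets j))
    (hnormals : ∀ j : Fin k, IsInwardNormal (newtonPolytope H) (facets j)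
      (fun i => N i (Fin.natAdd e j)))
    (hsub : ∀ j, smallF ⊆ facets j) (hN : N.det ≠ 0)
    (hdim : Module.finrank ℝ (directionSpace ((κ : ℝ) • smallF)) = e)
    (hsimplicial : (quotientFaceCone (enlargedPolytope H κ) ((κ : ℝ) • smallF)
      ((κ : ℝ) • latticeToReal v)).IsSimplicial) (j : Fin k) :
    ∃ m ∈ latticePoints (enlargedPolytope H κ), 0 < (Nᵀ *ᵥ (m - κ • v)) (Fin.natAdd e j) ∧
      ∀ i, i ≠ j → (Nᵀ *ᵥ (m - κ • v)) (Fin.natAdd e i) = 0 := by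
  have hκp : (0 : ℝ) < κ := by positivity
  have hQ : (· - (κ : ℝ) • latticeToReal v) '' enlargedPolytope H κ =
      (κ : ℝ) • ((· - latticeToReal v) '' newtonPolytope H) := by
    ext x
    constructor
    · rintro ⟨_, ⟨y, hy, rfl⟩, rfl⟩
      exact ⟨_, ⟨y, hy, rfl⟩, smul_sub _ _ _⟩
    · rintro ⟨_, ⟨y, hy, rfl⟩, rfl⟩
      exact ⟨_, ⟨y, hy, rfl⟩, (smul_sub _ _ _).symm⟩
  have hspanle : ∀ {S : Set (Fin (e + k) → ℝ)} {T : Set (Fin (e + k) → ℝ)},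
      (∀ x ∈ S, x - latticeToReal v ∈ Submodule.span ℝ T) →
      latticeToReal v ∈ S → vectorSpan ℝ S ≤ Submodule.span ℝ T := by
    intro S T hST hvS
    rw [vectorSpan_eq_span_vsub_set_right ℝ hvS]
    refine Submodule.span_le.2 ?_
    rintro _ ⟨x, hx, rfl⟩
    exact hST x hx
  have hspanmem : ∀ {T : Set (Fin (e + k) → ℝ)} {x : Fin (e + k) → ℝ}, (κ : ℝ) • x ∈ T →
      x ∈ Submodule.span ℝ T := by
    intro T x hx
    have := Submodule.smul_mem _ (κ : ℝ)⁻¹ (Submodule.subset_span (R := ℝ) hx)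
    rwa [smul_smul, inv_mul_cancel₀ hκp.ne', one_smul] at this
  obtain ⟨x, hx, hxj, hxi⟩ := exists_ray_of_isSimplicial (φ := normalMap N)
    (L := directionSpace ((κ : ℝ) • smallF))
    (A := (· - (κ : ℝ) • latticeToReal v) '' enlargedPolytope H κ)
    (directionSpace_eq_ker hnormals hsub hN hdim).symm (normalMap_surjective hN) (by
      rw [hQ]
      rintro _ ⟨_, ⟨y, hy, rfl⟩, rfl⟩ i
      change 0 ≤ normalMap N ((κ : ℝ) • (y - latticeToReal v)) i
      rw [map_smul]
      exact mul_nonneg hκp.le (normalMap_sub_nonneg (fun j => hsub j hv) hnormals hy i)) (by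
      intro i
      rw [hQ]
      let f : (Fin (e + k) → ℝ) →ₗ[ℝ] ℝ := LinearMap.proj i ∘ₗ normalMap N
      have hf : f ≠ 0 := by
        intro hf
        obtain ⟨y, hy⟩ := normalMap_surjective hN (Pi.single i 1)
        have h1 : f y = 1 := by
          change normalMap N y i = 1
          rw [hy, Pi.single_eq_same]
        rw [hf] at h1
        simp at h1
      -- Both have codimension one, so the kernel of the `i`-th coordinate is spanned by differences
      -- of points of the `i`-th facet.
      have h1 : directionSpace (facets i) = LinearMap.ker f := by
        refine Submodule.eq_of_le_of_finrank_eq (fun x hx => (hnormals i).2.1 x hx) ?_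
        have h2 := LinearMap.finrank_range_add_finrank_ker f
        rw [LinearMap.range_eq_top.2 (LinearMap.surjective hf), finrank_top] at h2
        have h3 := (hfacets i).2
        simp at h2
        omega
      intro x hx
      have h2 : x ∈ directionSpace (facets i) := by
        rw [h1]
        exact hx
      refine hspanle (fun y hy => ?_) (hsub i hv) h2
      refine hspanmem ⟨⟨_, ⟨y, ?_, rfl⟩, rfl⟩, ?_⟩
      · obtain ⟨l, hl⟩ := (hfacets i).1.2 (hfacets i).1.1
        rw [hl] at hy
        exact hy.1
      · have h3 : normalMap N (y - latticeToReal v) i = 0 :=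
          (hnormals i).2.1 _ (vsub_mem_vectorSpan ℝ hy (hsub i hv))
        change normalMap N ((κ : ℝ) • (y - latticeToReal v)) i = 0
        rw [map_smul, Pi.smul_apply, h3, smul_zero]) (by
      rw [hQ, eq_top_iff, ← AffineSubspace.direction_top ℝ (Fin (e + k) → ℝ) (Fin (e + k) → ℝ),
        ← hfull, direction_affineSpan]
      exact hspanle (fun y hy => hspanmem ⟨_, ⟨y, hy, rfl⟩, rfl⟩) hvP) hsimplicial j
  rw [hQ] at hx
  obtain ⟨_, ⟨y, hy, rfl⟩, rfl⟩ := hx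
  obtain ⟨w, hw0, hw1, hw2⟩ := exists_weights_of_mem_newtonPolytope hy
  have hφ : ∀ i, normalMap N ((κ : ℝ) • (y - latticeToReal v)) i =
      κ * ∑ a ∈ H.coeff.support, w a * normalMap N (latticeToReal a - latticeToReal v) i := by
    intro i
    have h1 : y - latticeToReal v =
        ∑ a ∈ H.coeff.support, w a • (latticeToReal a - latticeToReal v) := by
      simp only [smul_sub, Finset.sum_sub_distrib, hw2, ← Finset.sum_smul, hw1, one_smul]
    rw [h1, map_smul, map_sum, Pi.smul_apply, Finset.sum_apply]
    simp
  change 0 < normalMap N ((κ : ℝ) • (y - latticeToReal v)) j at hxj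
  have hxi' : ∀ i, i ≠ j → normalMap N ((κ : ℝ) • (y - latticeToReal v)) i = 0 := hxi
  have hnn : ∀ i, ∀ a ∈ H.coeff.support,
      0 ≤ w a * normalMap N (latticeToReal a - latticeToReal v) i := fun i a ha =>
    mul_nonneg (hw0 a ha) (normalMap_sub_nonneg (fun j => hsub j hv) hnormals
      (mem_newtonPolytope_of_mem_support ha) i)
  rw [hφ] at hxj
  obtain ⟨a, ha, hapos⟩ : ∃ a ∈ H.coeff.support,
      0 < w a * normalMap N (latticeToReal a - latticeToReal v) j := by
    refine Finset.exists_lt_of_sum_lt ?_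
    rw [Finset.sum_const_zero]
    exact pos_of_mul_pos_right hxj hκp.le
  have hmapa : ∀ i, (((Nᵀ *ᵥ (κ • a - κ • v)) (Fin.natAdd e i) : ℤ) : ℝ) =
      κ * normalMap N (latticeToReal a - latticeToReal v) i := by
    intro i
    rw [← normalMap_latticeToReal, ← smul_sub, latticeToReal_nsmul, latticeToReal_sub, map_smul]
    rfl
  have hwa : 0 < w a := lt_of_le_of_ne (hw0 a ha) fun h => by
    rw [← h, zero_mul] at hapos
    exact lt_irrefl _ hapos
  refine ⟨κ • a, ⟨_, mem_newtonPolytope_of_mem_support ha, (latticeToReal_nsmul _ _).symm⟩,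
    ?_, fun i hi => ?_⟩
  · have := mul_pos hκp (pos_of_mul_pos_right hapos hwa.le)
    rw [← hmapa] at this
    exact_mod_cast this
  · have h1 := hxi' i hi
    rw [hφ, mul_eq_zero, Finset.sum_eq_zero_iff_of_nonneg (hnn i)] at h1
    have h2 := (mul_eq_zero.1 (h1.resolve_left hκp.ne' a ha)).resolve_left hwa.ne'
    have h3 := hmapa i
    rw [h2, mul_zero] at h3
    exact_mod_cast h3

end Facets

/-! ### Limits of monomials -/

theorem projectivization_mk_eq_of_tendsto {ι α : Type*} {l : Filter α} [l.NeBot]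
    {f : α → ι → ℂ} (hf : ∀ a, f a ≠ 0) {x y : ι → ℂ} (hx : x ≠ 0) (hy : y ≠ 0)
    (h : Tendsto (fun a => Projectivization.mk ℂ (f a) (hf a)) l (𝓝 (Projectivization.mk ℂ x hx)))
    (h' : Tendsto (fun a => Projectivization.mk ℂ (f a) (hf a)) l
      (𝓝 (Projectivization.mk ℂ y hy))) :
    Projectivization.mk ℂ x hx = Projectivization.mk ℂ y hy := by
  obtain ⟨i, hi⟩ := Function.ne_iff.1 hx
  obtain ⟨i', hi'⟩ := Function.ne_iff.1 hy
  have h1 := tendsto_ratio_of_tendsto_projectivization hf hx h hi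
  have h2 := tendsto_ratio_of_tendsto_projectivization hf hy h' hi'
  have h3 : ∀ᶠ a in l, f a i' ≠ 0 := by
    have := h2 i'
    rw [div_self hi'] at this
    filter_upwards [this.eventually_ne one_ne_zero] with a ha h0
    exact ha (by simp [h0])
  rw [Projectivization.mk_eq_mk_iff']
  refine ⟨x i' / y i', funext fun j => ?_⟩
  have h4 : Tendsto (fun a => f a j / f a i) l (𝓝 (y j / y i' * (x i' / x i))) := by
    refine ((h2 j).mul (h1 i')).congr' ?_
    filter_upwards [h3] with a ha
    field_simp
  have h5 := tendsto_nhds_unique (h1 j) h4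
  have hi0 : x i ≠ 0 := hi
  have hi0' : y i' ≠ 0 := hi'
  rw [Pi.smul_apply, smul_eq_mul]
  field_simp at h5 ⊢
  rw [h5]

theorem tendsto_torusMonomial_of_tendsto_toricMap {d : ℕ} {H : LaurentPoly d} [NeZero H] {κ : ℕ}
    {p : ℙ ℂ (latticePoints (enlargedPolytope H κ) → ℂ)} {x : ℕ → Fin d → ℂˣ}
    (hx : Tendsto (fun n => toricMap H κ (x n)) atTop (𝓝 p))
    {m₀ : latticePoints (enlargedPolytope H κ)} (hm₀ : p.rep m₀ ≠ 0)
    (m : latticePoints (enlargedPolytope H κ)) :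
    Tendsto (fun n => (torusMonomial ((m : Fin d → ℤ) - (m₀ : Fin d → ℤ)) (x n) : ℂ)) atTop
      (𝓝 (p.rep m / p.rep m₀)) := by
  rw [← p.mk_rep] at hx
  have h1 := tendsto_ratio_of_tendsto_projectivization (fun n => toricCoords_ne_zero _ (x n))
    p.rep_nonzero hx hm₀ m
  refine h1.congr fun n => ?_
  rw [torusMonomial_sub]
  simp [toricCoords]

theorem tendsto_toricMap {d : ℕ} {H : LaurentPoly d} [NeZero H] {κ : ℕ}
    {p : ℙ ℂ (latticePoints (enlargedPolytope H κ) → ℂ)} {x : ℕ → Fin d → ℂˣ}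
    {m₀ : latticePoints (enlargedPolytope H κ)} (hm₀ : p.rep m₀ ≠ 0)
    (hx : ∀ m : latticePoints (enlargedPolytope H κ),
      Tendsto (fun n => (torusMonomial ((m : Fin d → ℤ) - (m₀ : Fin d → ℤ)) (x n) : ℂ)) atTop
        (𝓝 (p.rep m / p.rep m₀))) :
    Tendsto (fun n => toricMap H κ (x n)) atTop (𝓝 p) := by
  have h0 : (p.rep m₀)⁻¹ • p.rep ≠ 0 := smul_ne_zero (inv_ne_zero hm₀) p.rep_nonzero
  have h1 : p = Projectivization.mk ℂ _ h0 := by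
    conv_lhs => rw [← p.mk_rep]
    rw [Projectivization.mk_eq_mk_iff']
    exact ⟨p.rep m₀, by rw [smul_smul, mul_inv_cancel₀ hm₀, one_smul]⟩
  rw [h1]
  refine tendsto_projectivization_mk_of_smul
    (s := fun n => ((torusMonomial (m₀ : Fin d → ℤ) (x n) : ℂ))⁻¹) _ _ (tendsto_pi_nhds.2 fun m => ?_)
  have h2 := hx m
  rw [div_eq_inv_mul] at h2
  refine h2.congr fun n => ?_
  rw [torusMonomial_sub]
  simp [toricCoords, div_eq_inv_mul]

theorem tendsto_torusMonomial {d : ℕ} {Z : Fin d → ℂ} {a : Fin d → ℤ}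
    (ha : ∀ i, Z i ≠ 0 ∨ 0 ≤ a i) {w : ℕ → Fin d → ℂˣ}
    (hw : Tendsto (fun n => torusToAffine (w n)) atTop (𝓝 Z)) :
    Tendsto (fun n => (torusMonomial a (w n) : ℂ)) atTop (𝓝 (∏ i, Z i ^ a i)) := by
  simp only [coe_torusMonomial]
  exact (analyticAt_monomial ha).continuousAt.tendsto.comp hw

/-- The limit `c` is chosen before the sequence `x`: all sequences satisfying `P` share it, which
later allows two lifts to be compared. -/
theorem exists_limit_of_mem_closure {d : ℕ} {α : Type*} {l : Filter α} (P : (α → Fin d → ℂˣ) → Prop)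
    {S : Set (Fin d → ℤ)} (hS : ∀ a ∈ S, ∃ c : ℂ, c ≠ 0 ∧ ∀ x, P x →
      Tendsto (fun n => (torusMonomial a (x n) : ℂ)) l (𝓝 c))
    {b : Fin d → ℤ} (hb : b ∈ AddSubgroup.closure S) :
    ∃ c : ℂ, c ≠ 0 ∧ ∀ x, P x → Tendsto (fun n => (torusMonomial b (x n) : ℂ)) l (𝓝 c) := by
  induction hb using AddSubgroup.closure_induction with
  | mem a ha => exact hS a ha
  | zero => exact ⟨1, one_ne_zero, fun x _ => by simp [torusMonomial_zero, tendsto_const_nhds]⟩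
  | add a b _ _ ha hb =>
    obtain ⟨c, hc, h⟩ := ha
    obtain ⟨c', hc', h'⟩ := hb
    refine ⟨c * c', mul_ne_zero hc hc', fun x hx => ?_⟩
    simpa [torusMonomial_add] using (h x hx).mul (h' x hx)
  | neg a _ ha =>
    obtain ⟨c, hc, h⟩ := ha
    refine ⟨c⁻¹, inv_ne_zero hc, fun x hx => ?_⟩
    simpa [torusMonomial_neg] using (h x hx).inv₀ hc

theorem torusMonomial_single {d : ℕ} (i : Fin d) (n : ℤ) (z : Fin d → ℂˣ) :
    torusMonomial (Pi.single i n) z = z i ^ n := by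
  unfold torusMonomial
  rw [Finset.prod_eq_single i]
  · simp
  · intro j _ hj
    rw [Pi.single_eq_of_ne hj, zpow_zero]
  · simp

theorem torusMonomial_nsmul {d : ℕ} (n : ℕ) (a : Fin d → ℤ) (z : Fin d → ℂˣ) :
    torusMonomial (n • a) z = torusMonomial a z ^ n := by
  simp only [torusMonomial, ← Finset.prod_pow, Pi.smul_apply]
  exact Finset.prod_congr rfl fun i _ => by
    rw [nsmul_eq_mul, mul_comm, zpow_mul, zpow_natCast]

/-- A column of the adjugate, times the sign of the determinant so that the exponent is a natural
number. -/
theorem exists_mulVec_transpose_eq_single {d : ℕ} {N : Matrix (Fin d) (Fin d) ℤ} (i : Fin d) :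
    ∃ a, Nᵀ *ᵥ a = Pi.single i (N.det.natAbs : ℤ) := by
  have h1 : Nᵀ *ᵥ (Nᵀ.adjugate *ᵥ Pi.single i N.det.sign) = Pi.single i (N.det.natAbs : ℤ) := by
    rw [Matrix.mulVec_mulVec, Matrix.mul_adjugate, Matrix.det_transpose, Matrix.smul_mulVec,
      Matrix.one_mulVec, ← Pi.single_smul, smul_eq_mul, Int.mul_sign_self]
  exact ⟨_, h1⟩

theorem tendsto_zero_of_pow {α : Type*} {l : Filter α} {f : α → ℂ} {n : ℕ}
    (h : Tendsto (fun a => f a ^ n) l (𝓝 0)) : Tendsto f l (𝓝 0) := by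
  rw [Metric.tendsto_nhds] at h ⊢
  intro ε hε
  filter_upwards [h (ε ^ n) (by positivity)] with a ha
  rw [dist_zero_right, norm_pow] at ha
  rw [dist_zero_right]
  exact lt_of_pow_lt_pow_left₀ n hε.le ha

/-! ### Lifting convergent sequences through `τ_N`. -/

section Lifts

variable {e k : ℕ} {N : Matrix (Fin (e + k)) (Fin (e + k)) ℤ}
  {P : (ℕ → Fin (e + k) → ℂˣ) → Prop}

/-- The power `w_i ^ |det N|` is a monomial in `τ_N(w)` whose exponent is orthogonal to the normals.
-/
theorem exists_pow_tendsto (hN : N.det ≠ 0)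
    (hP : ∀ a, (∀ j, (Nᵀ *ᵥ a) (Fin.natAdd e j) = 0) → ∃ c : ℂ, c ≠ 0 ∧ ∀ x, P x →
      Tendsto (fun n => (torusMonomial a (x n) : ℂ)) atTop (𝓝 c)) (i : Fin e) :
    ∃ n c, n ≠ 0 ∧ c ≠ 0 ∧ ∀ w : ℕ → Fin (e + k) → ℂˣ, P (fun t => monomialMap N (w t)) →
      Tendsto (fun t => (w t (Fin.castAdd k i) : ℂ) ^ n) atTop (𝓝 c) := by
  obtain ⟨a, ha⟩ := exists_mulVec_transpose_eq_single (N := N) (Fin.castAdd k i)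
  obtain ⟨c, hc, h⟩ := hP a fun j => by
    rw [ha, Pi.single_eq_of_ne]
    intro h
    have := congrArg Fin.val h
    simp at this
    omega
  refine ⟨N.det.natAbs, c, Int.natAbs_ne_zero.2 hN, hc, fun w hw => ?_⟩
  refine (h _ hw).congr fun t => ?_
  rw [torusMonomial_monomialMap, ha, torusMonomial_single, zpow_natCast, Units.val_pow_eq_pow_val]

/-- With `b` the positive entry of `Nᵀ m` and `Nᵀ a = D e_j`, the exponent `D m - b a` is orthogonal
to the normals, so its monomial has a nonzero limit. Dividing it out of the `D`-th power of the ray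
monomial leaves `w_j ^ (D b)`, which must tend to `0`. -/
theorem tendsto_zero_of_ray (hN : N.det ≠ 0)
    (hP : ∀ a, (∀ j, (Nᵀ *ᵥ a) (Fin.natAdd e j) = 0) → ∃ c : ℂ, c ≠ 0 ∧ ∀ x, P x →
      Tendsto (fun n => (torusMonomial a (x n) : ℂ)) atTop (𝓝 c)) {j : Fin k}
    {m : Fin (e + k) → ℤ} (hmj : 0 < (Nᵀ *ᵥ m) (Fin.natAdd e j))
    (hmi : ∀ i, i ≠ j → (Nᵀ *ᵥ m) (Fin.natAdd e i) = 0)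
    (hm : ∀ x, P x → Tendsto (fun n => (torusMonomial m (x n) : ℂ)) atTop (𝓝 0))
    {w : ℕ → Fin (e + k) → ℂˣ} (hw : P (fun t => monomialMap N (w t))) :
    Tendsto (fun t => (w t (Fin.natAdd e j) : ℂ)) atTop (𝓝 0) := by
  obtain ⟨a, ha⟩ := exists_mulVec_transpose_eq_single (N := N) (Fin.natAdd e j)
  set D := N.det.natAbs with hD
  have hD0 : D ≠ 0 := Int.natAbs_ne_zero.2 hN
  obtain ⟨b, hb⟩ := Int.eq_ofNat_of_zero_le hmj.le
  obtain ⟨c, hc, h⟩ := hP (D • m - b • a) fun i => by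
    rw [Matrix.mulVec_sub, Matrix.mulVec_smul, Matrix.mulVec_smul, ha]
    by_cases hij : i = j
    · subst hij
      simp [hb, mul_comm]
    · have : Fin.natAdd e i ≠ Fin.natAdd e j := fun h => hij ((Fin.natAdd_inj e).1 h)
      simp [hmi i hij, Pi.single_eq_of_ne this]
  have h1 := ((hm _ hw).pow D).div (h _ hw) hc
  rw [zero_pow hD0, zero_div] at h1
  refine tendsto_zero_of_pow (n := D * b) (h1.congr fun t => ?_)
  have h2 : torusMonomial (b • a) (monomialMap N (w t)) = w t (Fin.natAdd e j) ^ (D * b) := by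
    rw [torusMonomial_nsmul, torusMonomial_monomialMap, ha, torusMonomial_single, pow_mul,
      zpow_natCast]
  have h3 : torusMonomial m (monomialMap N (w t)) ^ D /
      torusMonomial (D • m - b • a) (monomialMap N (w t)) = w t (Fin.natAdd e j) ^ (D * b) := by
    rw [← h2, torusMonomial_sub, torusMonomial_nsmul]
    exact div_div_cancel _ _
  simpa using congrArg Units.val h3

/-- Any lift is bounded: powers of the first `e` coordinates converge and the last `k` tend to `0`.
A subsequential limit `Z'` may differ from `Z`, but only by an element of `ker τ_N`, and multiplying
the lift by that element does not change its image. -/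
theorem exists_lift_tendsto (hN : N.det ≠ 0)
    (hP : ∀ a, (∀ j, (Nᵀ *ᵥ a) (Fin.natAdd e j) = 0) → ∃ c : ℂ, c ≠ 0 ∧ ∀ x, P x →
      Tendsto (fun n => (torusMonomial a (x n) : ℂ)) atTop (𝓝 c))
    (hP0 : ∀ w : ℕ → Fin (e + k) → ℂˣ, P (fun t => monomialMap N (w t)) →
      ∀ j, Tendsto (fun t => (w t (Fin.natAdd e j) : ℂ)) atTop (𝓝 0))
    {Z : Fin (e + k) → ℂ} {w : ℕ → Fin (e + k) → ℂˣ} (hw : P (fun t => monomialMap N (w t)))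
    (hZ : Tendsto (fun n => torusToAffine (w n)) atTop (𝓝 Z))
    (hZe : ∀ i, Z (Fin.castAdd k i) ≠ 0) (hZk : ∀ j, Z (Fin.natAdd e j) = 0)
    {x : ℕ → Fin (e + k) → ℂˣ} (hx : P x) :
    ∃ (φ : ℕ → ℕ) (u : ℕ → Fin (e + k) → ℂˣ), StrictMono φ ∧ (∀ n, monomialMap N (u n) = x (φ n)) ∧
      Tendsto (fun n => torusToAffine (u n)) atTop (𝓝 Z) := by
  choose u hu using fun n => exists_monomialMap_eq hN (x n)
  have hPu : P (fun t => monomialMap N (u t)) := by simpa only [hu] using hx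
  choose D c hD hc hlim using exists_pow_tendsto hN hP
  have hbdd : ∀ i, ∃ C : ℝ, ∀ n, ‖(u n i : ℂ)‖ ≤ C := by
    intro i
    induction i using Fin.addCases with
    | left i =>
      obtain ⟨C, hC⟩ := (Metric.isBounded_range_of_tendsto _ (hlim i u hPu)).exists_norm_le
      refine ⟨1 + C, fun n => ?_⟩
      have h1 := hC _ ⟨n, rfl⟩
      rw [norm_pow] at h1
      rcases le_total ‖(u n (Fin.castAdd k i) : ℂ)‖ 1 with h2 | h2
      · have := (pow_nonneg (norm_nonneg _) _).trans h1
        linarith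
      · have := le_self_pow₀ h2 (hD i)
        linarith
    | right j =>
      obtain ⟨C, hC⟩ := (Metric.isBounded_range_of_tendsto _ (hP0 u hPu j)).exists_norm_le
      exact ⟨C, fun n => hC _ ⟨n, rfl⟩⟩
  choose C hC using hbdd
  obtain ⟨Z', -, φ, hφ, hZ'⟩ := tendsto_subseq_of_bounded
    (Metric.isBounded_closedBall (x := (0 : Fin (e + k) → ℂ)) (r := ∑ i, |C i|))
    (x := fun n => torusToAffine (u n)) (fun n => by
      rw [mem_closedBall_zero_iff]
      refine (pi_norm_le_iff_of_nonneg (Finset.sum_nonneg fun _ _ => abs_nonneg _)).2 fun i => ?_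
      exact ((hC i n).trans (le_abs_self _)).trans
        (Finset.single_le_sum (f := fun i => |C i|) (fun _ _ => abs_nonneg _) (Finset.mem_univ i)))
  have hcoord : ∀ i, Tendsto (fun n => (u (φ n) i : ℂ)) atTop (𝓝 (Z' i)) := fun i =>
    tendsto_pi_nhds.1 hZ' i
  have hZe' : ∀ i, Z' (Fin.castAdd k i) ≠ 0 := by
    intro i h0
    have h1 := (hcoord (Fin.castAdd k i)).pow (D i)
    rw [h0, zero_pow (hD i)] at h1
    exact hc i (tendsto_nhds_unique ((hlim i u hPu).comp hφ.tendsto_atTop) h1)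
  have hZk' : ∀ j, Z' (Fin.natAdd e j) = 0 := fun j =>
    tendsto_nhds_unique (hcoord _) ((hP0 u hPu j).comp hφ.tendsto_atTop)
  -- The discrepancy between `Z` and `Z'`; the last coordinates are irrelevant since both points
  -- vanish there, and `1` is a default.
  let ζ : Fin (e + k) → ℂˣ := Fin.addCases
    (fun i => Units.mk0 (Z (Fin.castAdd k i) / Z' (Fin.castAdd k i)) (div_ne_zero (hZe i) (hZe' i)))
    fun _ => 1
  have hζe : ∀ i, (ζ (Fin.castAdd k i) : ℂ) = Z (Fin.castAdd k i) / Z' (Fin.castAdd k i) :=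
    fun i => by simp [ζ]
  obtain ⟨ω, hω1, hωζ⟩ := exists_monomialMap_eq_one (N := N) ζ (by
    intro a ha
    obtain ⟨c', hc', h'⟩ := hP a ha
    have hmon : ∀ {Y : Fin (e + k) → ℂ}, (∀ i, Y (Fin.castAdd k i) ≠ 0) →
        ∀ i, Y i ≠ 0 ∨ 0 ≤ (Nᵀ *ᵥ a) i := by
      intro Y hY i
      induction i using Fin.addCases with
      | left i => exact Or.inl (hY i)
      | right j => exact Or.inr (ha j).ge
    have h1 := tendsto_torusMonomial (hmon hZe) hZ
    have h2 := tendsto_torusMonomial (hmon hZe') (w := fun n => u (φ n)) hZ'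
    simp only [← torusMonomial_monomialMap] at h1 h2
    have h3 := tendsto_nhds_unique h1 (h' _ hw)
    have h4 := tendsto_nhds_unique h2 ((h' _ hPu).comp hφ.tendsto_atTop)
    have hprod : ∀ Y : Fin (e + k) → ℂ, ∏ i, Y i ^ (Nᵀ *ᵥ a) i =
        ∏ i : Fin e, Y (Fin.castAdd k i) ^ (Nᵀ *ᵥ a) (Fin.castAdd k i) := by
      intro Y
      rw [Fin.prod_univ_add]
      simp [ha]
    rw [hprod] at h3 h4
    ext
    rw [coe_torusMonomial, hprod]
    simp only [torusToAffine, hζe, div_zpow, Finset.prod_div_distrib, h3, h4]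
    simp [hc'])
  refine ⟨φ, fun n => u (φ n) * ω, hφ, fun n => ?_, tendsto_pi_nhds.2 fun i => ?_⟩
  · rw [← hu]
    funext i
    have := congrFun hω1 i
    simp only [monomialMap, Pi.one_apply] at this ⊢
    rw [torusMonomial_mul, this, mul_one]
  · have h1 : Tendsto (fun n => (u (φ n) i : ℂ) * (ω i : ℂ)) atTop (𝓝 (Z' i * (ω i : ℂ))) :=
      (hcoord i).mul_const _
    have h2 : Z' i * (ω i : ℂ) = Z i := by
      induction i using Fin.addCases with
      | left i =>
        rw [hωζ, hζe]
        have := hZe' i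
        field_simp
      | right j => rw [hZk, hZk', zero_mul]
    rw [h2] at h1
    refine h1.congr fun n => ?_
    simp [torusToAffine]

end Lifts

/-! ### The directions of the critical points at infinity -/

/-- The linear automorphism of `ℂᵈ` given by the transpose of an integer matrix that is invertible
over `ℚ`. -/
def transposeEquiv {d : ℕ} (N : Matrix (Fin d) (Fin d) ℤ) (hN : N.det ≠ 0) :
    (Fin d → ℂ) ≃ₗ[ℂ] (Fin d → ℂ) :=
  LinearEquiv.ofInjectiveEndo (N.map (Int.cast : ℤ → ℂ))ᵀ.mulVecLin (by
    rw [← LinearMap.ker_eq_bot, LinearMap.ker_eq_bot']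
    intro x hx
    refine Matrix.eq_zero_of_mulVec_eq_zero (M := (N.map (Int.cast : ℤ → ℂ))ᵀ) ?_ hx
    rw [Matrix.det_transpose, show (N.map (Int.cast : ℤ → ℂ)).det = (N.det : ℂ) from
      (Int.cast_det N).symm]
    exact_mod_cast hN)

theorem transposeEquiv_apply {d : ℕ} {N : Matrix (Fin d) (Fin d) ℤ} (hN : N.det ≠ 0)
    (x : Fin d → ℂ) : transposeEquiv N hN x = (N.map (Int.cast : ℤ → ℂ))ᵀ *ᵥ x := rfl

theorem continuous_transposeEquiv_symm {d : ℕ} {N : Matrix (Fin d) (Fin d) ℤ} (hN : N.det ≠ 0) :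
    Continuous (transposeEquiv N hN).symm :=
  LinearMap.continuous_of_finiteDimensional
    ((transposeEquiv N hN).symm : (Fin d → ℂ) →ₗ[ℂ] (Fin d → ℂ))

section Directions

variable {d : ℕ} {N : Matrix (Fin d) (Fin d) ℤ} {v : Fin d → ℤ} {H : LaurentPoly d}

theorem logGrad_eq_transposeEquiv_symm (hN : N.det ≠ 0) {w : Fin d → ℂˣ}
    (hw : monomialMap N w ∈ torusVariety H) :
    logGrad (evalLaurent H) (torusToAffine (monomialMap N w)) =
      (torusMonomial v (monomialMap N w) : ℂ) • (transposeEquiv N hN).symm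
        (logGrad (evalLaurent (transformedPoly N v H)) (torusToAffine w)) := by
  rw [logGrad_transformedPoly_torus N v H w hw, ← transposeEquiv_apply hN, map_smul,
    LinearEquiv.symm_apply_apply, smul_smul, torusMonomial_neg]
  simp

theorem monomialMap_mem_torusVariety_iff {w : Fin d → ℂˣ} :
    monomialMap N w ∈ torusVariety H ↔
      evalLaurent (transformedPoly N v H) (torusToAffine w) = 0 := by
  rw [evalLaurent_transformedPoly_torus, mul_eq_zero]
  simp [torusVariety]

/-- If a point on the transformed hypersurface is a nondegenerate zero of the log-gradient, limits
of log-normal directions along lifted sequences are given by the derivative of the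
log-gradient. -/
theorem exists_direction_of_tendsto (hN : N.det ≠ 0) {Z : Fin d → ℂ}
    (hh : AnalyticAt ℂ (evalLaurent (transformedPoly N v H)) Z)
    (h0 : evalLaurent (transformedPoly N v H) Z = 0)
    (hG : logGrad (evalLaurent (transformedPoly N v H)) Z = 0)
    (hJ : ∀ t, fderiv ℂ (evalLaurent (transformedPoly N v H)) Z t = 0 →
      fderiv ℂ (logGrad (evalLaurent (transformedPoly N v H))) Z t = 0 → t = 0)
    {w : ℕ → Fin d → ℂˣ} (hw : Tendsto (fun n => torusToAffine (w n)) atTop (𝓝 Z))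
    {r : ℕ → ℙ ℂ (Fin d → ℂ)} (hr : ∀ n, IsLogNormalPair H (monomialMap N (w n)) (r n))
    {R : ℙ ℂ (Fin d → ℂ)} (hR : Tendsto r atTop (𝓝 R)) :
    ∃ t, fderiv ℂ (evalLaurent (transformedPoly N v H)) Z t = 0 ∧
      R.submodule ≤ Submodule.span ℂ {(transposeEquiv N hN).symm
        (fderiv ℂ (logGrad (evalLaurent (transformedPoly N v H))) Z t)} := by
  set h := evalLaurent (transformedPoly N v H) with hdef
  have hwV : ∀ n, h (torusToAffine (w n)) = 0 := fun n =>
    monomialMap_mem_torusVariety_iff.1 (hr n).1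
  choose g0 hg using fun n => (hr n).2
  -- The log-gradient vanishes at `Z` but not at points carrying a log-normal direction.
  have hwZ : ∀ n, torusToAffine (w n) ≠ Z := by
    intro n hn
    refine g0 n ?_
    rw [logGrad_eq_transposeEquiv_symm (v := v) hN (hr n).1, ← hdef, hn, hG, map_zero, smul_zero]
  obtain ⟨t, φ, s, hφ, ht, ht0, hs⟩ := exists_limit_direction hh h0 hG hJ hw hwZ hwV
  have hne : (transposeEquiv N hN).symm (fderiv ℂ (logGrad h) Z t) ≠ 0 := by simpa using ht0
  refine ⟨t, ht, ?_⟩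
  have h1 : Tendsto (fun n => Projectivization.mk ℂ _ (g0 (φ n))) atTop
      (𝓝 (Projectivization.mk ℂ _ hne)) := by
    refine tendsto_projectivization_mk_of_smul
      (s := fun n => s n * ((torusMonomial v (monomialMap N (w (φ n))) : ℂ))⁻¹) _ _ ?_
    refine (((continuous_transposeEquiv_symm hN).tendsto _).comp hs).congr fun n => ?_
    rw [logGrad_eq_transposeEquiv_symm (v := v) hN (hr (φ n)).1, smul_smul, mul_assoc,
      inv_mul_cancel₀ (Units.ne_zero _), mul_one, ← map_smul]
    rfl
  have h2 : Tendsto (fun n => Projectivization.mk ℂ _ (g0 (φ n))) atTop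
      (𝓝 (Projectivization.mk ℂ _ R.rep_nonzero)) := by
    rw [Projectivization.mk_rep]
    simpa only [Function.comp_def, hg] using hR.comp hφ.tendsto_atTop
  have h3 := projectivization_mk_eq_of_tendsto (fun n => g0 (φ n)) hne R.rep_nonzero h1 h2
  rw [Projectivization.mk_rep] at h3
  rw [← h3, Projectivization.submodule_mk]

theorem exists_seq_of_direction (hN : N.det ≠ 0) {Z : Fin d → ℂ}
    (hh : AnalyticAt ℂ (evalLaurent (transformedPoly N v H)) Z)
    (h0 : evalLaurent (transformedPoly N v H) Z = 0)
    (hG : logGrad (evalLaurent (transformedPoly N v H)) Z = 0)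
    (hd : fderiv ℂ (evalLaurent (transformedPoly N v H)) Z ≠ 0) {t : Fin d → ℂ}
    (ht : fderiv ℂ (evalLaurent (transformedPoly N v H)) Z t = 0)
    {R : ℙ ℂ (Fin d → ℂ)} (hR : (transposeEquiv N hN).symm
      (fderiv ℂ (logGrad (evalLaurent (transformedPoly N v H))) Z t) = R.rep) :
    ∃ (w : ℕ → Fin d → ℂˣ) (r : ℕ → ℙ ℂ (Fin d → ℂ)),
      (∀ n, IsLogNormalPair H (monomialMap N (w n)) (r n)) ∧
      Tendsto (fun n => torusToAffine (w n)) atTop (𝓝 Z) ∧ Tendsto r atTop (𝓝 R) := by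
  have hJ : fderiv ℂ (logGrad (evalLaurent (transformedPoly N v H))) Z t ≠ 0 := by
    intro h
    rw [h, map_zero] at hR
    exact R.rep_nonzero hR.symm
  obtain ⟨w, s, hw0, hwG, hwZ, hs⟩ := exists_torus_seq hh h0 hG hd ht hJ
  have hV : ∀ n, monomialMap N (w n) ∈ torusVariety H := fun n =>
    monomialMap_mem_torusVariety_iff.2 (hw0 n)
  have hne : ∀ n, logGrad (evalLaurent H) (torusToAffine (monomialMap N (w n))) ≠ 0 := by
    intro n
    rw [logGrad_eq_transposeEquiv_symm (v := v) hN (hV n)]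
    exact smul_ne_zero (Units.ne_zero _) (by simpa using hwG n)
  refine ⟨w, fun n => Projectivization.mk ℂ _ (hne n), fun n => ⟨hV n, hne n, rfl⟩, hwZ, ?_⟩
  rw [← R.mk_rep]
  refine tendsto_projectivization_mk_of_smul
    (s := fun n => s n * ((torusMonomial v (monomialMap N (w n)) : ℂ))⁻¹) _ _ ?_
  rw [← hR]
  refine (((continuous_transposeEquiv_symm hN).tendsto _).comp hs).congr fun n => ?_
  rw [logGrad_eq_transposeEquiv_symm (v := v) hN (hV n), smul_smul, mul_assoc,
    inv_mul_cancel₀ (Units.ne_zero _), mul_one, ← map_smul]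
  rfl

theorem logGrad_transformedPoly_eq_zero {Z : Fin d → ℂ}
    (hh : AnalyticAt ℂ (evalLaurent (transformedPoly N v H)) Z) {w : ℕ → Fin d → ℂˣ}
    (hw : Tendsto (fun n => torusToAffine (w n)) atTop (𝓝 Z))
    (hV : ∀ n, monomialMap N (w n) ∈ torusVariety H)
    (hzero : Tendsto (fun n => (torusMonomial (-v) (monomialMap N (w n)) : ℂ) •
      logGrad (evalLaurent H) (torusToAffine (monomialMap N (w n)))) atTop (𝓝 0)) :
    logGrad (evalLaurent (transformedPoly N v H)) Z = 0 := by
  have h1 := (analyticAt_logGrad hh).continuousAt.tendsto.comp hw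
  refine tendsto_nhds_unique h1 ?_
  have hc : Continuous (N.map (Int.cast : ℤ → ℂ))ᵀ.mulVecLin :=
    LinearMap.continuous_of_finiteDimensional _
  have h2 := (hc.tendsto 0).comp hzero
  rw [map_zero] at h2
  refine h2.congr fun n => ?_
  simp only [Function.comp, Matrix.mulVecLin_apply]
  rw [logGrad_transformedPoly_torus N v H (w n) (hV n), Matrix.mulVec_smul]

end Directions

end

/-! ### The hyperplane of directions at `p`. -/

theorem mainTheorem5
    -- a Laurent polynomial in `d = e + k` variables with full-dimensional Newton polytope `𝒫`,
    -- smooth on the torus, and a factor `κ ≥ 1` for which `Q = κ 𝒫` is normal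
    {e k : ℕ} (H : LaurentPoly (e + k)) [NeZero H]
    (hfull : affineSpan ℝ (newtonPolytope H) = ⊤)
    (hsmooth : IsSmoothTorusVariety H)
    (κ : ℕ) (hκ : 1 ≤ κ) (hnormal : IsNormalPolytope (enlargedPolytope H κ))
    -- a face `ℱ` of `𝒫` of codimension `k`, the face `F = κ ℱ` of `Q`, a vertex `𝔳` of `ℱ`,
    -- with `σ_F / L_F` simplicial
    (smallF F : Set (Fin (e + k) → ℝ))
    (hface : IsFace (newtonPolytope H) smallF) (hF : F = (κ : ℝ) • smallF)
    (hdim : Module.finrank ℝ (directionSpace F) = e)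
    (v : Fin (e + k) → ℤ) (hv : latticeToReal v ∈ smallF.extremePoints ℝ)
    (hsimplicial :
      (quotientFaceCone (enlargedPolytope H κ) F ((κ : ℝ) • latticeToReal v)).IsSimplicial)
    -- a sequence in `V*` converging to `p ∈ X⁰(F)` with convergent log-gradient directions and
    -- with rescaled log-gradients tending to zero
    (z : ℕ → Fin (e + k) → ℂˣ) (r : ℕ → ℙ ℂ (Fin (e + k) → ℂ))
    (hz : ∀ n, IsLogNormalPair H (z n) (r n))
    (p : ℙ ℂ (latticePoints (enlargedPolytope H κ) → ℂ))
    (hp : p ∈ faceAtInfinityInterior H κ F)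
    (hzp : Tendsto (fun n => toricMap H κ (z n)) atTop (𝓝 p))
    (R : ℙ ℂ (Fin (e + k) → ℂ)) (hR : Tendsto r atTop (𝓝 R))
    (hzero : Tendsto (fun n => (torusMonomial (-v) (z n) : ℂ) •
      logGrad (evalLaurent H) (torusToAffine (z n))) atTop (𝓝 0))
    -- the `k` facets of `𝒫` that cut out `ℱ`, and an integer matrix `N`, invertible over `ℚ`,
    -- whose last `k` columns are their inward-pointing normals
    (facets : Fin k → Set (Fin (e + k) → ℝ))
    (hfacets : ∀ j, IsFacet (newtonPolytope H) (facets j))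
    (hinter : newtonPolytope H ∩ ⋂ j, facets j = smallF)
    (N : Matrix (Fin (e + k)) (Fin (e + k)) ℤ) (hN : N.det ≠ 0)
    (hnormals : ∀ j : Fin k, IsMinimalInwardNormal (newtonPolytope H) (facets j)
      (fun i => N i (Fin.natAdd e j)))
    -- a lift under `τ_N` of a subsequence of `z`, with limit `Z ∈ ℂᵈ`
    (w : ℕ → Fin (e + k) → ℂˣ) (sub : ℕ → ℕ) (hsub : StrictMono sub)
    (hw : ∀ n, monomialMap N (w n) = z (sub n))
    (Z : Fin (e + k) → ℂ) (hZ : Tendsto (fun n => torusToAffine (w n)) atTop (𝓝 Z))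
    -- the nondegeneracy conditions at `Z`
    (hgrad : grad (evalLaurent (transformedPoly N v H)) Z ≠ 0)
    (hrank : logGradJacobianRank (evalLaurent (transformedPoly N v H)) Z + 1 = e + k) :
    IsProjectiveHyperplane {R' | IsCPAI H κ p R'} ∧
      {R' | IsParallelTo R' F} ⊆ {R' | IsCPAI H κ p R'} := by
  subst hF
  have hinw : ∀ j : Fin k, IsInwardNormal (newtonPolytope H) (facets j)
      (fun i => N i (Fin.natAdd e j)) := fun j => (hnormals j).1
  have hvF : latticeToReal v ∈ smallF := hv.1
  have hsubset : ∀ j, smallF ⊆ facets j := fun j x hx => by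
    rw [← hinter] at hx
    exact Set.mem_iInter.1 hx.2 j
  have hvP : latticeToReal v ∈ newtonPolytope H := by
    rw [← hinter] at hvF
    exact hvF.1
  -- lattice points and the values of monomials at `p`
  let m₀ : latticePoints (enlargedPolytope H κ) :=
    ⟨κ • v, _, hvP, (latticeToReal_nsmul κ v).symm⟩
  have hm₀ : p.rep m₀ ≠ 0 := (hp.2 m₀).2 ⟨_, hvF, (latticeToReal_nsmul κ v).symm⟩
  let P : (ℕ → Fin (e + k) → ℂˣ) → Prop := fun x =>
    Tendsto (fun n => toricMap H κ (x n)) atTop (𝓝 p)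
  have hratio : ∀ (m : latticePoints (enlargedPolytope H κ)) (x), P x →
      Tendsto (fun n => (torusMonomial ((m : Fin (e + k) → ℤ) - κ • v) (x n) : ℂ)) atTop
        (𝓝 (p.rep m / p.rep m₀)) := fun m x hx =>
    tendsto_torusMonomial_of_tendsto_toricMap hx hm₀ m
  have hPlim : ∀ a, (∀ j, (Nᵀ *ᵥ a) (Fin.natAdd e j) = 0) → ∃ c : ℂ, c ≠ 0 ∧ ∀ x, P x →
      Tendsto (fun n => (torusMonomial a (x n) : ℂ)) atTop (𝓝 c) := by
    intro a ha
    refine exists_limit_of_mem_closure P ?_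
      (mem_closure_of_mem_directionSpace hκ hnormal hface hvF ?_)
    · rintro _ ⟨m, hmQ, hmF, rfl⟩
      exact ⟨_, div_ne_zero ((hp.2 ⟨m, hmQ⟩).2 hmF) hm₀, hratio ⟨m, hmQ⟩⟩
    · rw [directionSpace_eq_ker hinw hsubset hN hdim, LinearMap.mem_ker]
      funext j
      rw [normalMap_latticeToReal, ha j]
      simp
  have hray : ∀ j : Fin k, ∃ m : latticePoints (enlargedPolytope H κ), p.rep m = 0 ∧
      0 < (Nᵀ *ᵥ ((m : Fin (e + k) → ℤ) - κ • v)) (Fin.natAdd e j) ∧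
      ∀ i, i ≠ j → (Nᵀ *ᵥ ((m : Fin (e + k) → ℤ) - κ • v)) (Fin.natAdd e i) = 0 := by
    intro j
    obtain ⟨m, hmQ, hmj, hmi⟩ := exists_lattice_ray hκ hfull hvF hvP hfacets hinw hsubset hN hdim
      hsimplicial j
    refine ⟨⟨m, hmQ⟩, ?_, hmj, hmi⟩
    by_contra hne
    exact hmj.ne' (mulVec_transpose_eq_zero hvF hinw hsubset ((hp.2 _).1 hne) j)
  have hP0 : ∀ w : ℕ → Fin (e + k) → ℂˣ, P (fun t => monomialMap N (w t)) →
      ∀ j, Tendsto (fun t => (w t (Fin.natAdd e j) : ℂ)) atTop (𝓝 0) := by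
    intro w hw j
    obtain ⟨m, hm0, hmj, hmi⟩ := hray j
    refine tendsto_zero_of_ray hN hPlim hmj hmi (fun x hx => ?_) hw
    have := hratio m x hx
    rwa [hm0, zero_div] at this
  have hPw : P (fun t => monomialMap N (w t)) := by
    simp only [P, hw]
    exact hzp.comp hsub.tendsto_atTop
  have hZk : ∀ j, Z (Fin.natAdd e j) = 0 := fun j =>
    tendsto_nhds_unique (tendsto_pi_nhds.1 hZ _) (hP0 w hPw j)
  -- Some power of this coordinate of the lift has a nonzero limit.
  have hZe : ∀ i, Z (Fin.castAdd k i) ≠ 0 := by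
    intro i h0
    obtain ⟨n, c, hn, hc, hlim⟩ := exists_pow_tendsto hN hPlim i
    have h1 := (tendsto_pi_nhds.1 hZ (Fin.castAdd k i)).pow n
    rw [h0, zero_pow hn] at h1
    exact hc (tendsto_nhds_unique (hlim w hPw) h1)
  have hexp : ∀ a : Fin (e + k) → ℤ, (∀ j, 0 ≤ a (Fin.natAdd e j)) → ∀ i, Z i ≠ 0 ∨ 0 ≤ a i := by
    intro a ha i
    induction i using Fin.addCases with
    | left i => exact Or.inl (hZe i)
    | right j => exact Or.inr (ha j)
  -- the transformed hypersurface at `Z`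
  have hh : AnalyticAt ℂ (evalLaurent (transformedPoly N v H)) Z := by
    refine analyticAt_evalLaurent fun b hb => hexp b fun j => ?_
    obtain ⟨a, ha, rfl⟩ := exists_of_mem_support_transformedPoly hb
    have h1 := normalMap_sub_nonneg (fun j => hsubset j hvF) hinw
      (mem_newtonPolytope_of_mem_support ha) j
    rw [← latticeToReal_sub, normalMap_latticeToReal] at h1
    exact_mod_cast h1
  have hV : ∀ n, monomialMap N (w n) ∈ torusVariety H := fun n => by
    rw [hw]
    exact (hz _).1
  have h0 : evalLaurent (transformedPoly N v H) Z = 0 := by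
    refine tendsto_nhds_unique (hh.continuousAt.tendsto.comp hZ) ?_
    refine tendsto_const_nhds.congr fun n => ?_
    exact (monomialMap_mem_torusVariety_iff.1 (hV n)).symm
  have hG : logGrad (evalLaurent (transformedPoly N v H)) Z = 0 := by
    refine logGrad_transformedPoly_eq_zero hh hZ hV ?_
    simp only [hw]
    exact hzero.comp hsub.tendsto_atTop
  have hd : fderiv ℂ (evalLaurent (transformedPoly N v H)) Z ≠ 0 := fun h =>
    hgrad (funext fun j => by simp [grad, h])
  have hfin := finrank_ker_of_ne_zero hd
  have hJ : ∀ t, fderiv ℂ (evalLaurent (transformedPoly N v H)) Z t = 0 →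
      fderiv ℂ (logGrad (evalLaurent (transformedPoly N v H))) Z t = 0 → t = 0 := by
    intro t ht htJ
    unfold logGradJacobianRank at hrank
    exact eq_zero_of_finrank_map_eq (by omega) (LinearMap.mem_ker.2 ht) htJ
  -- `p` is not in the image of the torus
  have hpV : p ∉ toricMap H κ '' torusVariety H := by
    rintro ⟨x, -, rfl⟩
    -- A nonzero gradient with zero log-gradient forces a zero coordinate of `Z`, necessarily among
    -- the last `k`. The corresponding ray gives a vanishing coordinate of `p`, whereas all
    -- coordinates of a torus point are nonzero.
    obtain ⟨i, hi⟩ := Function.ne_iff.1 hgrad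
    have hZi : Z i = 0 := (mul_eq_zero.1 (congrFun hG i)).resolve_right hi
    induction i using Fin.addCases with
    | left i => exact hZe i hZi
    | right j =>
      obtain ⟨m, hm0, -⟩ := hray j
      obtain ⟨a, ha⟩ := Projectivization.exists_smul_eq_mk_rep ℂ _
        (toricCoords_ne_zero (enlargedPolytope H κ) x)
      have h1 : (a : ℂ) * toricCoords (enlargedPolytope H κ) x m = 0 := by
        rw [← hm0]
        exact congrFun ha m
      exact mul_ne_zero a.ne_zero (Units.ne_zero _) h1
  let W : Submodule ℂ (Fin (e + k) → ℂ) :=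
    ((LinearMap.ker (fderiv ℂ (evalLaurent (transformedPoly N v H)) Z :
      (Fin (e + k) → ℂ) →ₗ[ℂ] ℂ)).map
      (fderiv ℂ (logGrad (evalLaurent (transformedPoly N v H))) Z :
        (Fin (e + k) → ℂ) →ₗ[ℂ] (Fin (e + k) → ℂ))).map
      ((transposeEquiv N hN).symm : (Fin (e + k) → ℂ) →ₗ[ℂ] (Fin (e + k) → ℂ))
  have hWmem : ∀ x, x ∈ W ↔ ∃ t, fderiv ℂ (evalLaurent (transformedPoly N v H)) Z t = 0 ∧
      (transposeEquiv N hN).symm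
        (fderiv ℂ (logGrad (evalLaurent (transformedPoly N v H))) Z t) = x := by
    intro x
    constructor
    · rintro ⟨_, ⟨t, ht, rfl⟩, rfl⟩
      exact ⟨t, ht, rfl⟩
    · rintro ⟨t, ht, rfl⟩
      exact ⟨_, ⟨t, ht, rfl⟩, rfl⟩
  have hCPAI : {R' | IsCPAI H κ p R'} = {R' | R'.submodule ≤ W} := by
    ext R'
    constructor
    · rintro ⟨-, z', r', hz', hlim, hR'⟩
      obtain ⟨φ, u, hφ, hu, huZ⟩ := exists_lift_tendsto hN hPlim hP0 hPw hZ hZe hZk hlim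
      obtain ⟨t, ht, hle⟩ := exists_direction_of_tendsto (r := fun n => r' (φ n)) hN hh h0 hG hJ huZ
        (fun n => by rw [hu]; exact hz' _) (hR'.comp hφ.tendsto_atTop)
      refine hle.trans ((Submodule.span_singleton_le_iff_mem _ _).2 ?_)
      exact (hWmem _).2 ⟨t, ht, rfl⟩
    · intro hle
      have hrep : R'.rep ∈ W := hle (by
        rw [Projectivization.submodule_eq]
        exact Submodule.mem_span_singleton_self _)
      obtain ⟨t, ht, htR⟩ := (hWmem _).1 hrep
      obtain ⟨u, r', hur, huZ, hr'⟩ := exists_seq_of_direction hN hh h0 hG hd ht htR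
      refine ⟨hpV, fun n => monomialMap N (u n), r', hur, tendsto_toricMap hm₀ fun m => ?_, hr'⟩
      -- The coordinate ratios of `Φ` become monomials without poles at `Z`, so their limits depend
      -- on `Z` only; the given lift `w` identifies them with the ratios of `p`.
      have hm := hexp (Nᵀ *ᵥ ((m : Fin (e + k) → ℤ) - κ • v)) fun j =>
        mulVec_transpose_nonneg (fun j => hsubset j hvF) hinw m.2 j
      have h1 := tendsto_torusMonomial hm huZ
      have h2 := tendsto_torusMonomial hm hZ
      simp only [← torusMonomial_monomialMap] at h1 h2
      rwa [tendsto_nhds_unique h2 (hratio m _ hPw)] at h1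
  rw [hCPAI]
  refine ⟨⟨W, ?_, rfl⟩, fun R' hR' => ?_⟩
  · have h1 := LinearEquiv.finrank_map_eq (transposeEquiv N hN).symm
      ((LinearMap.ker (fderiv ℂ (evalLaurent (transformedPoly N v H)) Z :
      (Fin (e + k) → ℂ) →ₗ[ℂ] ℂ)).map
      (fderiv ℂ (logGrad (evalLaurent (transformedPoly N v H))) Z :
        (Fin (e + k) → ℂ) →ₗ[ℂ] (Fin (e + k) → ℂ)))
    exact (congrArg (· + 1) h1).trans hrank
  · refine le_trans hR' (Submodule.span_le.2 ?_)
    rintro _ ⟨x, hx, rfl⟩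
    -- For `x ∈ L_F` the last `k` entries of `Nᵀ x` are scalar products with the facet normals,
    -- hence zero.
    obtain ⟨t, ht, htx⟩ := mem_map_fderiv_logGrad hh hG hJ
      (x := transposeEquiv N hN fun i => (x i : ℂ)) (by
        intro i hi
        induction i using Fin.addCases with
        | left i => exact absurd hi (hZe i)
        | right j =>
          rw [SetLike.mem_coe, directionSpace_eq_ker hinw hsubset hN hdim, LinearMap.mem_ker] at hx
          have h1 := congrFun hx j
          rw [normalMap_apply] at h1
          have h2 : ((∑ i, (N i (Fin.natAdd e j) : ℝ) * x i : ℝ) : ℂ) = 0 := by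
            rw [Complex.ofReal_eq_zero]
            exact h1
          rw [transposeEquiv_apply]
          simp only [Matrix.mulVec, dotProduct, Matrix.transpose_apply, Matrix.map_apply]
          push_cast at h2
          exact h2)
    refine (hWmem _).2 ⟨t, ht, ?_⟩
    rw [htx, LinearEquiv.symm_apply_apply]
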